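/- **Setting.** Let $(\Omega,\mathcal F)$ be a measurable space and $\mathcal H$ a set of real random variables on it such that $I_A\in\mathcal H$ for all $A\in\mathcal F$, and $\varphi(X_1,\dots,X_n)\in\mathcal H$ whenever $X_1,\dots,X_n\in\mathcal H$ and $\varphi:\mathbb R^n\to\mathbb R$ satisfies $|\varphi(x)-\varphi(y)|\le C(1+|x|^m+|y|^m)|x-y|$ for all $x,y\in\mathbb R^n$ and some $C>0$, $m\in\mathbb N$. Let $\mathbb E:\mathcal H\to[-\infty,\infty]$ be a sublinear expectation: it is monotone, $\mathbb E[c]=c$ for $c\in\mathbb R$, $\mathbb E[\lambda X]=\lambda\mathbb E[X]$ for $\lambda\ge 0$, and $\mathbb E[X+Y]\le\mathbb E[X]+\mathbb E[Y]$ whenever the right side is not of the form $\infty-\infty$ or $-\infty+\infty$. Assume that $\mathbb E$ is countably sub-additive: $\mathbb E[X]\le\sum_{n\ge1}\mathbb E[X_n]$ whenever $X\le\sum_{n\ge 1}X_n$ with $0\le X\in\mathcal H$ and $0\le X_n\in\mathcal H$. Put $\mathbb V(A)=\inf\{\mathbb E[\xi]: I_A\le\xi,\ \xi\in\mathcal H\}$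 for $A\in\mathcal F$ and $$C_{\mathbb V}(X)=\int_0^\infty\mathbb V(X>x)\,dx+\int_{-\infty}^0(\mathbb V(X>x)-1)\,dx .$$ A random vector $\mathbf Y$ with components in $\mathcal H$ is *independent of* such a random vector $\mathbf X$ if for each Borel function $\psi$ with $\psi(\mathbf X,\mathbf Y)\in\mathcal H$ and $\psi(\mathbf x,\mathbf Y)\in\mathcal H$ for all $\mathbf x$, we have $\mathbb E[\psi(\mathbf X,\mathbf Y)]=\mathbb E\big[\mathbb E[\psi(\mathbf x,\mathbf Y)]|_{\mathbf x=\mathbf X}\big]$ whenever $\bar\psi(\mathbf x):=\mathbb E|\psi(\mathbf x,\mathbf Y)|<\infty$ for all $\mathbf x$ and $\mathbb E|\bar\psi(\mathbf X)|<\infty$ (the identity being required only when $\bar\psi(\mathbf X)$ and $\mathbb E[\psi(\mathbf x,\mathbf Y)]|_{\mathbf x=\mathbf X}$ belong to $\mathcal H$). A sequence $X_1,X_2,\dots$ is *independent* if $X_{n+1}$ is independent of $(X_1,\dots,X_n)$ for each $n\ge1$. Variables $X,X'\in\mathcal H$ are *identically distributed* if $\mathbb E[\psi(X)]=\mathbb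 E[\psi(X')]$ for each Borel $\psi$ with $\psi(X),\psi(X')\in\mathcal H$ for which both expectations are finite. **Theorem 3.1.** Let $X\in\mathcal H$, and let $X_1,X_2,\dots\in\mathcal H$ be an independent sequence, each $X_n$ being identically distributed with $X$. Let $r>1$, $p>\frac12$, $\beta+p>0$, and, if $\frac12<p\le1$, suppose that $\mathbb E[X]=-\mathbb E[-X]=0$. Let $\{a_{ni}:1\le i\le n,\ n\ge1\}$ be real numbers with $a_{ni}\approx(i/n)^\beta(1/n)^p$, that is, there are $C>0$ and $N$ such that $C^{-1}(i/n)^\beta n^{-p}\le a_{ni}\le C(i/n)^\beta n^{-p}$ for all $n\ge N$ and $1\le i\le n$. Then the following are equivalent: (i) $$\begin{cases}C_{\mathbb V}\big(|X|^{(r-1)/(p+\beta)}\big)<\infty, & \text{if } -p<\beta<-p/r,\\ C_{\mathbb V}\big(|X|^{r/p}\ln(1+|X|)\big)<\infty, & \text{if } \beta=-p/r,\\ C_{\mathbb V}\big(|X|^{r/p}\big)<\infty, & \text{if } \beta>-p/r;\end{cases}$$ (ii) $$\sum_{n=1}^\infty n^{r-2}\,\mathbb V\Big(\max_{1\le j\le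 n}\Big|\sum_{i=1}^j a_{ni}X_i\Big|>\epsilon\Big)<\infty\quad\text{for all }\epsilon>0 .$$ -/

import Mathlib

open MeasureTheory
open scoped ENNReal

/-- The class `C_{l,Lip}(ℝ^d)` of locally Lipschitz functions of polynomial growth. (All norms on
`ℝ^d` give the same class; the supremum norm of `Fin d → ℝ` is used here.) -/
def IsLocLip {d : ℕ} (φ : (Fin d → ℝ) → ℝ) : Prop :=
  ∃ C : ℝ, 0 < C ∧ ∃ m : ℕ, ∀ x y : Fin d → ℝ,
    |φ x - φ y| ≤ C * (1 + ‖x‖ ^ m + ‖y‖ ^ m) * ‖x - y‖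

/-- A sublinear expectation space `(Ω, H, E)` over the measurable space `Ω`. The expectation is
a functional on `H`: its values at functions outside `H` are unconstrained, and no definition
below makes use of them. -/
structure SublinearExpectationSpace (Ω : Type*) [MeasurableSpace Ω] where
  /-- the set of random variables on which the expectation is defined -/
  H : Set (Ω → ℝ)
  measurable_of_mem : ∀ X ∈ H, Measurable X
  indicator_mem : ∀ A : Set Ω, MeasurableSet A → A.indicator (fun _ => (1 : ℝ)) ∈ H
  comp_mem : ∀ (d : ℕ) (X : Fin d → Ω → ℝ) (φ : (Fin d → ℝ) → ℝ),
    (∀ i, X i ∈ H) → IsLocLip φ → (fun ω => φ (fun i => X i ω)) ∈ H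
  /-- the sublinear expectation -/
  E : (Ω → ℝ) → EReal
  mono : ∀ X ∈ H, ∀ Y ∈ H, (∀ ω, Y ω ≤ X ω) → E Y ≤ E X
  const : ∀ c : ℝ, E (fun _ => c) = (c : EReal)
  pos_homogeneous : ∀ X ∈ H, ∀ l : ℝ, 0 ≤ l → E (fun ω => l * X ω) = (l : EReal) * E X
  subadditive : ∀ X ∈ H, ∀ Y ∈ H, ¬(E X = ⊤ ∧ E Y = ⊥) → ¬(E X = ⊥ ∧ E Y = ⊤) →
    E (fun ω => X ω + Y ω) ≤ E X + E Y

namespace SublinearExpectationSpace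

variable {Ω : Type*} [MeasurableSpace Ω]

/-- Countable sub-additivity: `E X ≤ ∑ E Xₙ` whenever `X ≤ ∑ Xₙ` pointwise, all variables being
nonnegative elements of `H`. Both series are series of nonnegative terms and may be infinite. -/
def CountablySubadditive (S : SublinearExpectationSpace Ω) : Prop :=
  ∀ (X : Ω → ℝ) (Y : ℕ → Ω → ℝ), X ∈ S.H → (∀ n, Y n ∈ S.H) →
    (∀ ω, 0 ≤ X ω) → (∀ n ω, 0 ≤ Y n ω) →
    (∀ ω, ENNReal.ofReal (X ω) ≤ ∑' n, ENNReal.ofReal (Y n ω)) →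
    S.E X ≤ ((∑' n, (S.E (Y n)).toENNReal : ℝ≥0∞) : EReal)

/-- The capacity `V(A) = inf {E ξ : I_A ≤ ξ, ξ ∈ H}`. The infimum lies in `[0, 1]`, so nothing
is lost in regarding it as an element of `[0, ∞]`. -/
noncomputable def capacity (S : SublinearExpectationSpace Ω) (A : Set Ω) : ℝ≥0∞ :=
  (sInf {e : EReal | ∃ ξ ∈ S.H,
    (∀ ω, A.indicator (fun _ => (1 : ℝ)) ω ≤ ξ ω) ∧ e = S.E ξ}).toENNReal

/-- The Choquet expectation
`C_V(X) = ∫_0^∞ V(X > x) dx + ∫_{-∞}^0 (V(X > x) - 1) dx`, as an extended real number. -/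
noncomputable def choquet (S : SublinearExpectationSpace Ω) (X : Ω → ℝ) : EReal :=
  ((∫⁻ x in Set.Ioi (0 : ℝ), S.capacity {ω | x < X ω} : ℝ≥0∞) : EReal)
    - ((∫⁻ x in Set.Iio (0 : ℝ), (1 - S.capacity {ω | x < X ω}) : ℝ≥0∞) : EReal)

/-- The random vector `Y` is independent of the random vector `X`: for every Borel function `ψ`
with `ψ(X, Y), ψ(x, Y) ∈ H` for all `x`, `E ψ(X, Y) = E [ (E ψ(x, Y))|_{x = X} ]` whenever
`ψ'(x) = E |ψ(x, Y)| < ∞` for all `x` and `E |ψ'(X)| < ∞`. Since `E` is a functional on `H`, the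
latter two expectations are meaningful only if the variables in question belong to `H`. -/
def IndepOf (S : SublinearExpectationSpace Ω) {m n : ℕ}
    (Y : Fin n → Ω → ℝ) (X : Fin m → Ω → ℝ) : Prop :=
  ∀ ψ : (Fin m → ℝ) × (Fin n → ℝ) → ℝ, Measurable ψ →
    (fun ω => ψ (fun i => X i ω, fun j => Y j ω)) ∈ S.H →
    (∀ x : Fin m → ℝ, (fun ω => ψ (x, fun j => Y j ω)) ∈ S.H) →
    (∀ x : Fin m → ℝ, S.E (fun ω => |ψ (x, fun j => Y j ω)|) < ⊤) →
    (fun ω => (S.E (fun ω' => |ψ (fun i => X i ω, fun j => Y j ω')|)).toReal) ∈ S.H →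
    S.E (fun ω => |(S.E (fun ω' => |ψ (fun i => X i ω, fun j => Y j ω')|)).toReal|) < ⊤ →
    (fun ω => (S.E (fun ω' => ψ (fun i => X i ω, fun j => Y j ω'))).toReal) ∈ S.H →
    S.E (fun ω => ψ (fun i => X i ω, fun j => Y j ω)) =
      S.E (fun ω => (S.E (fun ω' => ψ (fun i => X i ω, fun j => Y j ω'))).toReal)

/-- The sequence `X 1, X 2, …` is independent: `X (n + 1)` is independent of `(X 1, …, X n)` for
each `n ≥ 1`. (The entry `X 0` plays no role.) -/
def IndepSeq (S : SublinearExpectationSpace Ω) (X : ℕ → Ω → ℝ) : Prop :=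
  ∀ n : ℕ, 1 ≤ n →
    S.IndepOf (fun _ : Fin 1 => X (n + 1)) (fun i : Fin n => X ((i : ℕ) + 1))

/-- Random vectors on two sublinear expectation spaces are identically distributed: for every
Borel function `ψ` such that `ψ(X₁) ∈ H₁` and `ψ(X₂) ∈ H₂`, one has `E₁ ψ(X₁) = E₂ ψ(X₂)` whenever
these are finite. -/
def IdentDistributed {Ω₁ Ω₂ : Type*} [MeasurableSpace Ω₁] [MeasurableSpace Ω₂]
    (S₁ : SublinearExpectationSpace Ω₁) (S₂ : SublinearExpectationSpace Ω₂) {d : ℕ}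
    (X₁ : Fin d → Ω₁ → ℝ) (X₂ : Fin d → Ω₂ → ℝ) : Prop :=
  ∀ ψ : (Fin d → ℝ) → ℝ, Measurable ψ →
    (fun ω => ψ (fun i => X₁ i ω)) ∈ S₁.H → (fun ω => ψ (fun i => X₂ i ω)) ∈ S₂.H →
    S₁.E (fun ω => ψ (fun i => X₁ i ω)) ≠ ⊤ → S₁.E (fun ω => ψ (fun i => X₁ i ω)) ≠ ⊥ →
    S₂.E (fun ω => ψ (fun i => X₂ i ω)) ≠ ⊤ → S₂.E (fun ω => ψ (fun i => X₂ i ω)) ≠ ⊥ →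
    S₁.E (fun ω => ψ (fun i => X₁ i ω)) = S₂.E (fun ω => ψ (fun i => X₂ i ω))

end SublinearExpectationSpace

/-- `a_{ni} ≪ b_{ni}` for triangular arrays indexed by `1 ≤ i ≤ n`: there is a constant `C > 0`
such that `a_{ni} ≤ C b_{ni}` for all `n` large enough and all `1 ≤ i ≤ n`. -/
def ArrayLL (a b : ℕ → ℕ → ℝ) : Prop :=
  ∃ C : ℝ, 0 < C ∧ ∃ N : ℕ, ∀ n, N ≤ n → ∀ i, 1 ≤ i → i ≤ n → a n i ≤ C * b n i

/-- `a_{ni} ≈ b_{ni}`: both `a_{ni} ≪ b_{ni}` and `b_{ni} ≪ a_{ni}`. -/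
def ArrayApprox (a b : ℕ → ℕ → ℝ) : Prop :=
  ArrayLL a b ∧ ArrayLL b a

/-- `max_{1 ≤ j ≤ n} |∑_{i=1}^j a_{ni} X_i(ω)|`. -/
noncomputable def maxWeightedSum {Ω : Type*} (a : ℕ → ℕ → ℝ) (X : ℕ → Ω → ℝ) (n : ℕ+) (ω : Ω) :
    ℝ :=
  (Finset.Icc 1 (n : ℕ)).sup' (Finset.nonempty_Icc.2 (Nat.succ_le_of_lt n.pos))
    (fun j => |∑ i ∈ Finset.Icc 1 j, a n i * X i ω|)

/-! Both conditions are equivalent to finiteness of the series `∑ₙ n^(r-2) ∑_{i ≤ n} V(|X| > c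
n^(p+β) i^(-β))`, called `tailSeries`, for any constant `c > 0`; up to constants its thresholds are
the reciprocals of the weights `a n i`.

Choquet integral and series (`choquet_comp_abs_lt_top_iff`). Let `f` be the gauge in (i). The series
is the integral of the antitone function `x ↦ V(f|X| > x)` against a discrete measure, and the
Choquet expectation is the integral of the same function against Lebesgue measure on `(0, ∞)`. By
the layer-cake formula the two are comparable as soon as the measures of half-lines are
(`lintegral_le_of_measure_Iic_le`). Count the discrete mass below a level `U`: for fixed `i`, the
index `n` runs from `i` to `(U i^β)^(1/(p+β))` and contributes about `U^s i^(βs)` with `s =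
(r-1)/(p+β)`, while `i` runs up to about `U^(1/p)` (`growthSum`). The three cases of (i) are `βs <
-1`, `βs = -1` and `βs > -1`: the sum over `i` is bounded, logarithmic or a power.

From the series to (ii) (`exists_capacity_sumEvent_le`). Truncate the summands at a level `δ`. The
capacity that some summand exceeds `δ` is paid for by the tail series. The truncated sums obey an
exponential maximal inequality: a product of independent nonnegative factors of expectation at most
one, stopped when it passes a level, still has expectation at most one, since the past enters the
increments only as a nonnegative multiplier, and there positive homogeneity replaces linearity.
Dyadic decomposition and countable subadditivity bound the truncated moments by a multiple of `a^q`,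
with `1/p < q < 2`, and `∑ᵢ (a n i)^q = O(n^(-η))`. With parameter `(r/ε) log n` and `δ`
proportional to `η ε / r` the exponential bound is `O(n^(-r))`, summable against `n^(r-2)`. The zero
mean enters when `p ≤ 1`, where `q > 1`.

From (ii) to the series (`tailSeries_lt_top_of_tsum_capacity_lt_top`). A large summand forces one of
two consecutive partial sums to be large. By independence the capacity of a union is exactly `1 - ∏
(1 - V(Aᵢ))`; once this is at most `1/2`, it is at least half of `∑ V(Aᵢ)`. It eventually is at most
`1/2`, because (ii), read on the block `[n, 2n]`, shows that `n^(r-1)` times it stays bounded. -/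

namespace IsLocLip

theorem of_bound {d : ℕ} {φ : (Fin d → ℝ) → ℝ} (C : ℝ) (h : ∀ x y, |φ x - φ y| ≤ C * ‖x - y‖) :
    IsLocLip φ := by
  refine ⟨|C| + 1, by positivity, 0, fun x y => (h x y).trans ?_⟩
  have h1 : C * ‖x - y‖ ≤ |C| * ‖x - y‖ := by gcongr; exact le_abs_self C
  have h2 : 0 ≤ |C| * ‖x - y‖ := by positivity
  have h3 := norm_nonneg (x - y)
  simp only [pow_zero]
  nlinarith

end IsLocLip

/-! ### Closure properties of `H`, the expectation on bounded variables, the capacity. -/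

namespace SublinearExpectationSpace

variable {Ω : Type*} [MeasurableSpace Ω] (S : SublinearExpectationSpace Ω)

section Membership

variable {S} {X Y : Ω → ℝ}

theorem const_mem (c : ℝ) : (fun _ : Ω => c) ∈ S.H :=
  S.comp_mem 0 (fun i => i.elim0) (fun _ => c) (fun i => i.elim0)
    (IsLocLip.of_bound 0 (by simp))

theorem lipschitz_mem (hX : X ∈ S.H) {φ : ℝ → ℝ} (C : ℝ)
    (hφ : ∀ x y, |φ x - φ y| ≤ C * |x - y|) : (fun ω => φ (X ω)) ∈ S.H := by
  refine S.comp_mem 1 (fun _ => X) (fun x => φ (x 0)) (fun _ => hX)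
    (IsLocLip.of_bound |C| fun x y => (hφ _ _).trans ?_)
  have h1 : |x 0 - y 0| ≤ ‖x - y‖ := norm_le_pi_norm (x - y) 0
  calc C * |x 0 - y 0| ≤ |C| * |x 0 - y 0| := by gcongr; exact le_abs_self C
    _ ≤ |C| * ‖x - y‖ := by gcongr

theorem add_mem (hX : X ∈ S.H) (hY : Y ∈ S.H) : (fun ω => X ω + Y ω) ∈ S.H := by
  have h := S.comp_mem 2 ![X, Y] (fun x => x 0 + x 1)
    (by intro i; fin_cases i <;> simpa) (IsLocLip.of_bound 2 fun x y => ?_)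
  · simpa using h
  · have h0 : |x 0 - y 0| ≤ ‖x - y‖ := norm_le_pi_norm (x - y) 0
    have h1 : |x 1 - y 1| ≤ ‖x - y‖ := norm_le_pi_norm (x - y) 1
    have : x 0 + x 1 - (y 0 + y 1) = (x 0 - y 0) + (x 1 - y 1) := by ring
    rw [this]
    linarith [abs_add_le (x 0 - y 0) (x 1 - y 1)]

theorem mul_mem (hX : X ∈ S.H) (hY : Y ∈ S.H) : (fun ω => X ω * Y ω) ∈ S.H := by
  have h := S.comp_mem 2 ![X, Y] (fun x => x 0 * x 1)
    (by intro i; fin_cases i <;> simpa) ⟨1, one_pos, 1, fun x y => ?_⟩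
  · simpa using h
  · have h0 : |x 0 - y 0| ≤ ‖x - y‖ := norm_le_pi_norm (x - y) 0
    have h1 : |x 1 - y 1| ≤ ‖x - y‖ := norm_le_pi_norm (x - y) 1
    have h2 : |x 1| ≤ ‖x‖ := norm_le_pi_norm x 1
    have h3 : |y 0| ≤ ‖y‖ := norm_le_pi_norm y 0
    have : x 0 * x 1 - y 0 * y 1 = (x 0 - y 0) * x 1 + y 0 * (x 1 - y 1) := by ring
    rw [this]
    calc _ ≤ |x 0 - y 0| * |x 1| + |y 0| * |x 1 - y 1| := by
          rw [← abs_mul, ← abs_mul]; exact abs_add_le _ _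
      _ ≤ ‖x - y‖ * ‖x‖ + ‖y‖ * ‖x - y‖ := by gcongr
      _ ≤ 1 * (1 + ‖x‖ ^ 1 + ‖y‖ ^ 1) * ‖x - y‖ := by nlinarith [norm_nonneg (x - y)]

theorem const_mul_mem (hX : X ∈ S.H) (c : ℝ) : (fun ω => c * X ω) ∈ S.H :=
  mul_mem (const_mem c) hX

theorem abs_mem (hX : X ∈ S.H) : (fun ω => |X ω|) ∈ S.H :=
  lipschitz_mem hX 1 fun x y => by simpa using abs_abs_sub_abs_le x y

theorem min_const_mem (hX : X ∈ S.H) (c : ℝ) : (fun ω => min (X ω) c) ∈ S.H :=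
  lipschitz_mem hX (φ := fun x => min x c) 1
    fun x y => by simpa using abs_min_sub_min_le_max x c y c

theorem max_const_mem (hX : X ∈ S.H) (c : ℝ) : (fun ω => max (X ω) c) ∈ S.H :=
  lipschitz_mem hX (φ := fun x => max x c) 1
    fun x y => by simpa using abs_max_sub_max_le_max x c y c

end Membership

/-- Bounded random variables of the space. -/
def Bounded (X : Ω → ℝ) : Prop := X ∈ S.H ∧ ∃ C : ℝ, ∀ ω, |X ω| ≤ C

/-- The real-valued expectation of bounded random variables. -/
noncomputable def er (X : Ω → ℝ) : ℝ := (S.E X).toReal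

variable {S} {X Y : Ω → ℝ}

namespace Bounded

theorem const (c : ℝ) : S.Bounded (fun _ => c) := ⟨const_mem c, |c|, fun _ => le_rfl⟩

theorem add (hX : S.Bounded X) (hY : S.Bounded Y) : S.Bounded (fun ω => X ω + Y ω) := by
  obtain ⟨hX, C, hC⟩ := hX
  obtain ⟨hY, D, hD⟩ := hY
  exact ⟨add_mem hX hY, C + D, fun ω => (abs_add_le _ _).trans (add_le_add (hC ω) (hD ω))⟩

theorem mul (hX : S.Bounded X) (hY : S.Bounded Y) : S.Bounded (fun ω => X ω * Y ω) := by
  obtain ⟨hX, C, hC⟩ := hX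
  obtain ⟨hY, D, hD⟩ := hY
  refine ⟨mul_mem hX hY, C * D, fun ω => ?_⟩
  rw [abs_mul]
  exact mul_le_mul (hC ω) (hD ω) (abs_nonneg _) ((abs_nonneg _).trans (hC ω))

theorem const_mul (hX : S.Bounded X) (c : ℝ) : S.Bounded (fun ω => c * X ω) :=
  (Bounded.const c).mul hX

theorem neg (hX : S.Bounded X) : S.Bounded (fun ω => -X ω) := by simpa using hX.const_mul (-1)

theorem sub (hX : S.Bounded X) (hY : S.Bounded Y) : S.Bounded (fun ω => X ω - Y ω) := by
  simpa [sub_eq_add_neg] using hX.add hY.neg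

theorem abs (hX : S.Bounded X) : S.Bounded (fun ω => |X ω|) := by
  obtain ⟨hX, C, hC⟩ := hX
  exact ⟨abs_mem hX, C, fun ω => by simpa using hC ω⟩

theorem indicator {A : Set Ω} (hA : MeasurableSet A) :
    S.Bounded (A.indicator fun _ => (1 : ℝ)) :=
  ⟨S.indicator_mem A hA, 1, fun ω => by by_cases h : ω ∈ A <;> simp [h]⟩

/-- Monotonicity pins the expectation between two real constants. Hence all arithmetic with bounded
variables can be done in `ℝ`, where `∞ - ∞` does not arise. -/
theorem coe_er (hX : S.Bounded X) : ((S.er X : ℝ) : EReal) = S.E X := by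
  obtain ⟨hX, C, hC⟩ := hX
  refine EReal.coe_toReal (fun h => ?_) (fun h => ?_)
  · have := S.mono _ (const_mem C) _ hX (fun ω => (abs_le.1 (hC ω)).2)
    rw [h, S.const] at this
    exact EReal.coe_ne_top C (top_le_iff.1 this)
  · have := S.mono _ hX _ (const_mem (-C)) (fun ω => (abs_le.1 (hC ω)).1)
    rw [h, S.const] at this
    exact EReal.coe_ne_bot (-C) (le_bot_iff.1 this)

end Bounded

theorem er_const (c : ℝ) : S.er (fun _ => c) = c := by simp [er, S.const]

theorem er_mono (hX : S.Bounded X) (hY : S.Bounded Y) (h : ∀ ω, X ω ≤ Y ω) : S.er X ≤ S.er Y := by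
  have := S.mono _ hY.1 _ hX.1 h
  rw [← hX.coe_er, ← hY.coe_er] at this
  exact_mod_cast this

theorem er_add_le (hX : S.Bounded X) (hY : S.Bounded Y) :
    S.er (fun ω => X ω + Y ω) ≤ S.er X + S.er Y := by
  have := S.subadditive _ hX.1 _ hY.1 (by rw [← hX.coe_er]; simp) (by rw [← hX.coe_er]; simp)
  rw [← hX.coe_er, ← hY.coe_er, ← (hX.add hY).coe_er] at this
  exact_mod_cast this

theorem er_const_mul (hX : S.Bounded X) {l : ℝ} (hl : 0 ≤ l) :
    S.er (fun ω => l * X ω) = l * S.er X := by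
  have := S.pos_homogeneous _ hX.1 l hl
  rw [← hX.coe_er, ← (hX.const_mul l).coe_er] at this
  exact_mod_cast this

/-- Subadditivity, applied once with `c` and once with `-c`, gives equality: constants are the
summands for which `E` is additive. -/
theorem er_const_add (hX : S.Bounded X) (c : ℝ) : S.er (fun ω => c + X ω) = c + S.er X := by
  apply le_antisymm
  · simpa [er_const] using er_add_le (Bounded.const c) hX
  · have := er_add_le (Bounded.const (-c)) ((Bounded.const c).add hX)
    simp only [neg_add_cancel_left, er_const] at this
    linarith

theorem er_nonneg (hX : S.Bounded X) (h : ∀ ω, 0 ≤ X ω) : 0 ≤ S.er X := by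
  simpa [er_const] using er_mono (Bounded.const 0) hX h

theorem er_le_of_le (hX : S.Bounded X) {c : ℝ} (h : ∀ ω, X ω ≤ c) : S.er X ≤ c := by
  simpa [er_const] using er_mono hX (Bounded.const c) h

theorem capacity_mono {A B : Set Ω} (h : A ⊆ B) : S.capacity A ≤ S.capacity B := by
  refine EReal.toENNReal_le_toENNReal (sInf_le_sInf ?_)
  rintro e ⟨ξ, hξ, hle, rfl⟩
  exact ⟨ξ, hξ, fun ω =>
    (Set.indicator_le_indicator_of_subset h (fun _ => zero_le_one) ω).trans (hle ω), rfl⟩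

/-- The indicator of a measurable set lies in `H`, so the infimum is attained there. -/
theorem capacity_eq_er {A : Set Ω} (hA : MeasurableSet A) :
    S.capacity A = ENNReal.ofReal (S.er (A.indicator fun _ => (1 : ℝ))) := by
  have : sInf {e : EReal | ∃ ξ ∈ S.H,
      (∀ ω, A.indicator (fun _ => (1 : ℝ)) ω ≤ ξ ω) ∧ e = S.E ξ}
      = S.E (A.indicator fun _ => (1 : ℝ)) := by
    apply le_antisymm
    · exact sInf_le ⟨_, S.indicator_mem A hA, fun _ => le_rfl, rfl⟩
    · refine le_sInf ?_
      rintro e ⟨ξ, hξ, hle, rfl⟩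
      exact S.mono _ hξ _ (S.indicator_mem A hA) hle
  rw [capacity, this, ← (Bounded.indicator hA).coe_er]
  simp

theorem capacity_le_of_indicator_le {A : Set Ω} (hX : S.Bounded X)
    (h : ∀ ω, A.indicator (fun _ => (1 : ℝ)) ω ≤ X ω) :
    S.capacity A ≤ ENNReal.ofReal (S.er X) := by
  have : sInf {e : EReal | ∃ ξ ∈ S.H,
      (∀ ω, A.indicator (fun _ => (1 : ℝ)) ω ≤ ξ ω) ∧ e = S.E ξ} ≤ S.E X :=
    sInf_le ⟨_, hX.1, h, rfl⟩
  rw [← hX.coe_er] at this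
  simpa [capacity] using EReal.toENNReal_le_toENNReal this

theorem capacity_le_one (A : Set Ω) : S.capacity A ≤ 1 := by
  have := capacity_le_of_indicator_le (S := S) (A := A) (Bounded.const 1)
    (fun ω => by by_cases h : ω ∈ A <;> simp [h])
  simpa [er_const] using this

theorem capacity_univ : S.capacity Set.univ = 1 := by
  rw [capacity_eq_er MeasurableSet.univ, Set.indicator_univ, er_const]
  simp

theorem capacity_union_le {A B : Set Ω} (hA : MeasurableSet A) (hB : MeasurableSet B) :
    S.capacity (A ∪ B) ≤ S.capacity A + S.capacity B := by
  rw [capacity_eq_er hA, capacity_eq_er hB, ← ENNReal.ofReal_add]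
  · refine (capacity_le_of_indicator_le ((Bounded.indicator hA).add (Bounded.indicator hB))
      fun ω => ?_).trans
      (ENNReal.ofReal_le_ofReal (er_add_le (Bounded.indicator hA) (Bounded.indicator hB)))
    by_cases h1 : ω ∈ A <;> by_cases h2 : ω ∈ B <;> simp [h1, h2]
  · exact er_nonneg (Bounded.indicator hA) fun ω => Set.indicator_nonneg (by simp) ω
  · exact er_nonneg (Bounded.indicator hB) fun ω => Set.indicator_nonneg (by simp) ω

theorem capacity_biUnion_le {ι : Type*} (s : Finset ι) {A : ι → Set Ω}
    (hA : ∀ i ∈ s, MeasurableSet (A i)) :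
    S.capacity (⋃ i ∈ s, A i) ≤ ∑ i ∈ s, S.capacity (A i) := by
  classical
  induction s using Finset.induction_on with
  | empty =>
    have : S.capacity (∅ : Set Ω) = 0 := by
      rw [capacity_eq_er MeasurableSet.empty, Set.indicator_empty, er_const]; simp
    simp [this]
  | insert i s hi ih =>
    rw [Finset.set_biUnion_insert, Finset.sum_insert hi]
    have h1 : ∀ j ∈ s, MeasurableSet (A j) := fun j hj => hA j (Finset.mem_insert_of_mem hj)
    refine (capacity_union_le (hA i (Finset.mem_insert_self i s))
      (Finset.measurableSet_biUnion s h1)).trans ?_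
    gcongr
    exact ih h1

/-- Countable subadditivity for a variable dominated by a series of weighted events. -/
theorem CountablySubadditive.le_tsum (hS : S.CountablySubadditive) (hX : X ∈ S.H)
    (hX0 : ∀ ω, 0 ≤ X ω) {c : ℕ → ℝ} (hc : ∀ k, 0 ≤ c k) {A : ℕ → Set Ω}
    (hA : ∀ k, MeasurableSet (A k)) {b : ℕ → ℝ} (hb : ∀ k, S.er ((A k).indicator fun _ => 1) ≤ b k)
    (hsum : Summable fun k => c k * b k)
    (hle : ∀ ω, 0 < X ω → ∃ k, ω ∈ A k ∧ X ω ≤ c k) :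
    S.E X ≤ ((∑' k, c k * b k : ℝ) : EReal) := by
  have hbd : ∀ k, S.Bounded fun ω => c k * (A k).indicator (fun _ => (1 : ℝ)) ω :=
    fun k => (Bounded.indicator (hA k)).const_mul (c k)
  have h0 : ∀ k ω, 0 ≤ c k * (A k).indicator (fun _ => (1 : ℝ)) ω := fun k ω =>
    mul_nonneg (hc k) (Set.indicator_nonneg (fun _ _ => zero_le_one) ω)
  have hb0 : ∀ k, 0 ≤ b k := fun k =>
    (er_nonneg (Bounded.indicator (hA k))
      (Set.indicator_nonneg fun _ _ => zero_le_one)).trans (hb k)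
  have key := hS X (fun k ω => c k * (A k).indicator (fun _ => (1 : ℝ)) ω) hX
    (fun k => (hbd k).1) hX0 h0 (fun ω => by
      rcases (hX0 ω).eq_or_lt with h | h
      · simp [← h]
      · obtain ⟨k, hk, hle'⟩ := hle ω h
        refine le_trans ?_ (ENNReal.le_tsum k)
        exact ENNReal.ofReal_le_ofReal (by simpa [hk] using hle'))
  refine key.trans ?_
  have h1 : ∑' k, (S.E fun ω => c k * (A k).indicator (fun _ => (1 : ℝ)) ω).toENNReal
      ≤ ENNReal.ofReal (∑' k, c k * b k) := by
    rw [ENNReal.ofReal_tsum_of_nonneg (fun k => mul_nonneg (hc k) (hb0 k)) hsum]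
    refine ENNReal.tsum_le_tsum fun k => ?_
    rw [← (hbd k).coe_er, EReal.toENNReal_of_ne_top (EReal.coe_ne_top _), EReal.toReal_coe,
      er_const_mul (Bounded.indicator (hA k)) (hc k)]
    exact ENNReal.ofReal_le_ofReal (mul_le_mul_of_nonneg_left (hb k) (hc k))
  calc _ ≤ ((ENNReal.ofReal (∑' k, c k * b k) : ℝ≥0∞) : EReal) := by exact_mod_cast h1
    _ = _ := by
      rw [EReal.coe_ennreal_ofReal, max_eq_left]
      exact tsum_nonneg fun k => mul_nonneg (hc k) (hb0 k)

theorem CountablySubadditive.er_le_tsum (hS : S.CountablySubadditive) (hX : S.Bounded X)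
    (hX0 : ∀ ω, 0 ≤ X ω) {c : ℕ → ℝ} (hc : ∀ k, 0 ≤ c k) {A : ℕ → Set Ω}
    (hA : ∀ k, MeasurableSet (A k)) {b : ℕ → ℝ} (hb : ∀ k, S.er ((A k).indicator fun _ => 1) ≤ b k)
    (hsum : Summable fun k => c k * b k)
    (hle : ∀ ω, 0 < X ω → ∃ k, ω ∈ A k ∧ X ω ≤ c k) :
    S.er X ≤ ∑' k, c k * b k := by
  have := hS.le_tsum hX.1 hX0 hc hA hb hsum hle
  rw [← hX.coe_er] at this
  exact_mod_cast this

end SublinearExpectationSpace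

/-! ### Independence: stopped products and unions of events. -/

namespace SublinearExpectationSpace

variable {Ω : Type*}

/-- `Z` is a Borel function of `X 1, …, X k`. -/
def Adapted (X : ℕ → Ω → ℝ) (k : ℕ) (Z : Ω → ℝ) : Prop :=
  ∃ W : (Fin k → ℝ) → ℝ, Measurable W ∧ ∀ ω, Z ω = W fun i => X ((i : ℕ) + 1) ω

namespace Adapted

variable {X : ℕ → Ω → ℝ} {k : ℕ} {Z : Ω → ℝ}

theorem const (c : ℝ) : Adapted X k fun _ => c := ⟨fun _ => c, measurable_const, fun _ => rfl⟩

theorem comp (hZ : Adapted X k Z) {f : ℝ → ℝ} (hf : Measurable f) :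
    Adapted X k fun ω => f (Z ω) := by
  obtain ⟨W, hW, h⟩ := hZ
  exact ⟨fun x => f (W x), hf.comp hW, fun ω => congrArg f (h ω)⟩

theorem succ (hZ : Adapted X k Z) {F : ℝ × ℝ → ℝ} (hF : Measurable F) :
    Adapted X (k + 1) fun ω => F (Z ω, X (k + 1) ω) := by
  obtain ⟨W, hW, h⟩ := hZ
  refine ⟨fun x => F (W (fun i => x i.castSucc), x (Fin.last k)), ?_, fun ω => ?_⟩
  · have h1 : Measurable fun x : Fin (k + 1) → ℝ => W (fun i => x i.castSucc) :=
      hW.comp (measurable_pi_lambda _ fun i => measurable_pi_apply _)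
    exact hF.comp (h1.prodMk (measurable_pi_apply _))
  · simp [h]

end Adapted

section Maximal

variable {X : ℕ → Ω → ℝ}

/-- The partial products of `D i (X i)`, stopped when they first exceed `A`. -/
noncomputable def stoppedProd (X : ℕ → Ω → ℝ) (D : ℕ → ℝ → ℝ) (A : ℝ) : ℕ → Ω → ℝ
  | 0 => fun _ => 1
  | k + 1 => fun ω => if stoppedProd X D A k ω ≤ A
      then stoppedProd X D A k ω * D (k + 1) (X (k + 1) ω) else stoppedProd X D A k ω

variable {D : ℕ → ℝ → ℝ} {A : ℝ}

theorem stoppedProd_succ (k : ℕ) (ω : Ω) :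
    stoppedProd X D A (k + 1) ω = if stoppedProd X D A k ω ≤ A
      then stoppedProd X D A k ω * D (k + 1) (X (k + 1) ω) else stoppedProd X D A k ω := rfl

theorem stoppedProd_nonneg (hD0 : ∀ i x, 0 ≤ D i x) (k : ℕ) (ω : Ω) :
    0 ≤ stoppedProd X D A k ω := by
  induction k with
  | zero => exact zero_le_one
  | succ k ih =>
    rw [stoppedProd_succ]
    split_ifs
    · exact mul_nonneg ih (hD0 _ _)
    · exact ih

theorem stoppedProd_adapted (hD : ∀ i, Measurable (D i)) (k : ℕ) :
    Adapted X k (stoppedProd X D A k) := by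
  induction k with
  | zero => exact Adapted.const 1
  | succ k ih =>
    refine ih.succ (F := fun z => if z.1 ≤ A then z.1 * D (k + 1) z.2 else z.1) ?_
    exact Measurable.ite (measurableSet_le measurable_fst measurable_const)
      (measurable_fst.mul ((hD _).comp measurable_snd)) measurable_fst

/-- The increment is put in the form (nonnegative function of the past) times (function of the next
variable), the only form to which `IndepSeq.er_mul` applies. -/
theorem stoppedProd_succ_eq (k : ℕ) (ω : Ω) :
    stoppedProd X D A (k + 1) ω = stoppedProd X D A k ω
      + ({ω | stoppedProd X D A k ω ≤ A}.indicator (fun _ => (1 : ℝ)) ω * stoppedProd X D A k ω)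
        * (-1 + D (k + 1) (X (k + 1) ω)) := by
  rw [stoppedProd_succ]
  by_cases h : stoppedProd X D A k ω ≤ A
  · simp [h]; ring
  · simp [h]

/-- Once the process exceeds `A` it is frozen, so its value at time `k` remembers whether some
earlier product exceeded `A`. Thus a maximal event is read off from a single variable. -/
theorem stoppedProd_gt_of_lt (ω : Ω) (k : ℕ) :
    (∃ j ≤ k, A < ∏ i ∈ Finset.Icc 1 j, D i (X i ω)) ∧ A < stoppedProd X D A k ω ∨
      (¬ ∃ j ≤ k, A < ∏ i ∈ Finset.Icc 1 j, D i (X i ω)) ∧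
        stoppedProd X D A k ω = ∏ i ∈ Finset.Icc 1 k, D i (X i ω) := by
  induction k with
  | zero =>
    by_cases h : A < 1
    · left; simp [stoppedProd, h]
    · right; simpa [stoppedProd] using h
  | succ k ih =>
    rcases ih with ⟨⟨j, hj, hA⟩, h⟩ | ⟨h1, h2⟩
    · left
      refine ⟨⟨j, hj.trans k.le_succ, hA⟩, ?_⟩
      rw [stoppedProd_succ, if_neg (not_le.2 h)]
      exact h
    · have h3 : stoppedProd X D A k ω ≤ A := by
        rw [h2]; by_contra hlt; exact h1 ⟨k, le_rfl, not_le.1 hlt⟩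
      have h4 : stoppedProd X D A (k + 1) ω = ∏ i ∈ Finset.Icc 1 (k + 1), D i (X i ω) := by
        rw [stoppedProd_succ, if_pos h3, h2, Finset.prod_Icc_succ_top (by omega)]
      by_cases h5 : A < ∏ i ∈ Finset.Icc 1 (k + 1), D i (X i ω)
      · exact Or.inl ⟨⟨k + 1, le_rfl, h5⟩, h4 ▸ h5⟩
      · refine Or.inr ⟨?_, h4⟩
        rintro ⟨j, hj, hA⟩
        rcases hj.lt_or_eq with hj | rfl
        · exact h1 ⟨j, by omega, hA⟩
        · exact h5 hA

end Maximal

variable [MeasurableSpace Ω] {S : SublinearExpectationSpace Ω}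

/-- The sign of `Z` is essential: for fixed `z ≥ 0` positive homogeneity gives `E[z φ] = z E[φ]`,
and independence allows `z` to be replaced by `Z`. The sign of `φ` is arbitrary. -/
theorem IndepSeq.er_mul {X : ℕ → Ω → ℝ} (hX : S.IndepSeq X) {k : ℕ} {Z : Ω → ℝ}
    (hZa : Adapted X k Z) (hZ : S.Bounded Z) (hZ0 : ∀ ω, 0 ≤ Z ω) {φ : ℝ → ℝ} (hφ : Measurable φ)
    (hφX : S.Bounded fun ω => φ (X (k + 1) ω)) :
    S.er (fun ω => Z ω * φ (X (k + 1) ω))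
      = S.er fun ω => Z ω * S.er fun ω' => φ (X (k + 1) ω') := by
  obtain ⟨W, hW, hWZ⟩ := hZa
  rcases Nat.eq_zero_or_pos k with rfl | hk
  -- Independence is assumed only from the second variable on. For `k = 0` a function of the empty
  -- tuple is a constant, and homogeneity suffices; its sign is read off at a point of `Ω`, whence
  -- the separate case of empty `Ω`.
  · have hc : ∀ ω, Z ω = W default := fun ω => by rw [hWZ]; congr 1; exact Subsingleton.elim _ _
    by_cases hΩ : Nonempty Ω
    · obtain ⟨ω₀⟩ := hΩ
      have h0 : 0 ≤ W default := hc ω₀ ▸ hZ0 ω₀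
      simp only [hc]
      rw [er_const_mul hφX h0, er_const]
    · have : ∀ f g : Ω → ℝ, f = g := fun f g => funext fun ω => (hΩ ⟨ω⟩).elim
      congr 1
      exact this _ _
  have habs : ∀ ω, (S.E fun ω' => |W (fun i => X ((i : ℕ) + 1) ω) * φ (X (k + 1) ω')|).toReal
      = Z ω * S.er fun ω' => |φ (X (k + 1) ω')| := fun ω => by
    rw [← hWZ, ← er_const_mul hφX.abs (hZ0 ω)]
    simp only [abs_mul, abs_of_nonneg (hZ0 ω)]
    rfl
  have hmul : ∀ ω, (S.E fun ω' => W (fun i => X ((i : ℕ) + 1) ω) * φ (X (k + 1) ω')).toReal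
      = Z ω * S.er fun ω' => φ (X (k + 1) ω') := fun ω => by
    rw [← hWZ, ← er_const_mul hφX (hZ0 ω)]
    rfl
  have hB : ∀ c : ℝ, S.Bounded fun ω => Z ω * c := fun c => hZ.mul (Bounded.const c)
  have key := hX k hk (fun z => W z.1 * φ (z.2 0))
    ((hW.comp measurable_fst).mul (hφ.comp ((measurable_pi_apply 0).comp measurable_snd)))
    (by simpa only [← hWZ] using (hZ.mul hφX).1)
    (fun x => (hφX.const_mul (W x)).1)
    (fun x => by
      rw [← (hφX.const_mul (W x)).abs.coe_er]
      exact EReal.coe_lt_top _)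
    (by simpa only [habs] using (hB _).1)
    (by
      simp only [habs]
      rw [← (hB _).abs.coe_er]
      exact EReal.coe_lt_top _)
    (by simpa only [hmul] using (hB _).1)
  simp only [hmul] at key
  simp only [← hWZ] at key
  exact congrArg EReal.toReal key

variable {X : ℕ → Ω → ℝ} {D : ℕ → ℝ → ℝ} {A : ℝ}

theorem stoppedProd_bounded (hDX : ∀ i, 1 ≤ i → S.Bounded fun ω => D i (X i ω)) (k : ℕ) :
    S.Bounded (stoppedProd X D A k) := by
  induction k with
  | zero => exact Bounded.const 1
  | succ k ih =>
    rw [funext (stoppedProd_succ_eq k)]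
    have hm : MeasurableSet {ω | stoppedProd X D A k ω ≤ A} :=
      measurableSet_le (S.measurable_of_mem _ ih.1) measurable_const
    exact ih.add (((Bounded.indicator hm).mul ih).mul
      ((Bounded.const (-1)).add (hDX (k + 1) (by omega))))

/-- The supermartingale property: the factor `-1 + D` has nonpositive expectation, so by
`IndepSeq.er_mul` each increment does too, and subadditivity passes this on to the process. -/
theorem IndepSeq.er_stoppedProd_le (hX : S.IndepSeq X) (hD : ∀ i, Measurable (D i))
    (hD0 : ∀ i x, 0 ≤ D i x) (hDX : ∀ i, 1 ≤ i → S.Bounded fun ω => D i (X i ω))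
    (hE : ∀ i, 1 ≤ i → S.er (fun ω => D i (X i ω)) ≤ 1) (k : ℕ) :
    S.er (stoppedProd X D A k) ≤ 1 := by
  induction k with
  | zero => exact (er_const (S := S) 1).le
  | succ k ih =>
    rw [funext (stoppedProd_succ_eq k)]
    have hN := stoppedProd_bounded (A := A) hDX k
    have hm : MeasurableSet {ω | stoppedProd X D A k ω ≤ A} :=
      measurableSet_le (S.measurable_of_mem _ hN.1) measurable_const
    have hZ := (Bounded.indicator (S := S) hm).mul hN
    have hφ := (Bounded.const (-1)).add (hDX (k + 1) (by omega))
    have hZ0 : ∀ ω, 0 ≤ {ω | stoppedProd X D A k ω ≤ A}.indicator (fun _ => (1 : ℝ)) ω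
        * stoppedProd X D A k ω := fun ω =>
      mul_nonneg (Set.indicator_nonneg (fun _ _ => zero_le_one) ω) (stoppedProd_nonneg hD0 k ω)
    have hZa : Adapted X k fun ω => {ω | stoppedProd X D A k ω ≤ A}.indicator (fun _ => (1 : ℝ)) ω
        * stoppedProd X D A k ω := by
      refine ((stoppedProd_adapted hD k).comp
        (f := fun z => {z | z ≤ A}.indicator (fun _ => (1 : ℝ)) z * z) ?_)
      exact (measurable_const.indicator measurableSet_Iic).mul measurable_id
    refine (er_add_le hN (hZ.mul hφ)).trans ?_
    have h1 := hX.er_mul hZa hZ hZ0 (φ := fun x => -1 + D (k + 1) x)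
      (measurable_const.add (hD _)) hφ
    have h2 : S.er (fun ω => -1 + D (k + 1) (X (k + 1) ω)) ≤ 0 := by
      rw [er_const_add (hDX (k + 1) (by omega))]
      linarith [hE (k + 1) (by omega)]
    have h3 := er_le_of_le (hZ.mul (Bounded.const (S.er fun ω => -1 + D (k + 1) (X (k + 1) ω))))
      (c := 0) fun ω => mul_nonpos_of_nonneg_of_nonpos (hZ0 ω) h2
    linarith

/-- Maximal inequality for products of independent nonnegative variables of expectation at
most one. -/
theorem IndepSeq.capacity_exists_lt_prod_le (hX : S.IndepSeq X) (hD : ∀ i, Measurable (D i))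
    (hD0 : ∀ i x, 0 ≤ D i x) (hDX : ∀ i, 1 ≤ i → S.Bounded fun ω => D i (X i ω))
    (hE : ∀ i, 1 ≤ i → S.er (fun ω => D i (X i ω)) ≤ 1) (hA : 0 < A) (n : ℕ) :
    S.capacity {ω | ∃ j ≤ n, A < ∏ i ∈ Finset.Icc 1 j, D i (X i ω)} ≤ ENNReal.ofReal A⁻¹ := by
  have hN := stoppedProd_bounded (A := A) hDX n
  refine (capacity_le_of_indicator_le (hN.const_mul A⁻¹) fun ω => ?_).trans
    (ENNReal.ofReal_le_ofReal ?_)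
  · by_cases h : ∃ j ≤ n, A < ∏ i ∈ Finset.Icc 1 j, D i (X i ω)
    · rcases stoppedProd_gt_of_lt (D := D) (X := X) (A := A) ω n with ⟨-, h'⟩ | ⟨h', -⟩
      · rw [Set.indicator_of_mem (by exact h), inv_mul_eq_div, le_div_iff₀ hA]
        linarith
      · exact absurd h h'
    · rw [Set.indicator_of_notMem (by exact h)]
      exact mul_nonneg (inv_nonneg.2 hA.le) (stoppedProd_nonneg hD0 n ω)
  · rw [er_const_mul hN (inv_nonneg.2 hA.le)]
    exact mul_le_of_le_one_right (inv_nonneg.2 hA.le) (hX.er_stoppedProd_le hD hD0 hDX hE n)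

/-- The capacity of a union of independent events. -/
theorem IndepSeq.capacity_exists_mem_eq (hX : S.IndepSeq X) (hXm : ∀ i, 1 ≤ i → Measurable (X i))
    {B : ℕ → Set ℝ} (hB : ∀ i, MeasurableSet (B i)) (n : ℕ) :
    S.capacity {ω | ∃ i ∈ Finset.Icc 1 n, X i ω ∈ B i} = ENNReal.ofReal
      (1 - ∏ i ∈ Finset.Icc 1 n, (1 - S.er ((X i ⁻¹' B i).indicator fun _ => 1))) := by
  let Q : ℕ → Ω → ℝ := fun n ω => ∏ i ∈ Finset.Icc 1 n, (1 - (B i).indicator (fun _ => 1) (X i ω))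
  have hI : ∀ i, 1 ≤ i → S.Bounded fun ω => (B i).indicator (fun _ => (1 : ℝ)) (X i ω) :=
    fun i hi => Bounded.indicator (S := S) (hXm i hi (hB i))
  have hsucc : ∀ n, Q (n + 1) = fun ω =>
      Q n ω * (1 - (B (n + 1)).indicator (fun _ => 1) (X (n + 1) ω)) := fun n => by
    funext ω; exact Finset.prod_Icc_succ_top (by omega) _
  have hQb : ∀ n, S.Bounded (Q n) := by
    intro n
    induction n with
    | zero => exact Bounded.const 1
    | succ n ih =>
      rw [hsucc]
      exact ih.mul ((Bounded.const 1).sub (hI _ (by omega)))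
  have hQ0 : ∀ n ω, 0 ≤ Q n ω := fun n ω => Finset.prod_nonneg fun i _ => by
    by_cases h : X i ω ∈ B i <;> simp [h]
  have hQa : ∀ n, Adapted X n (Q n) := by
    intro n
    induction n with
    | zero => exact Adapted.const 1
    | succ n ih =>
      rw [hsucc]
      refine ih.succ (F := fun z => z.1 * (1 - (B (n + 1)).indicator (fun _ => 1) z.2)) ?_
      exact measurable_fst.mul (measurable_const.sub
        ((measurable_const.indicator (hB _)).comp measurable_snd))
  -- The induction runs on `-Q` because the next factor must appear as `-1 + I`, whose expectation
  -- is `-1 + V`; that of `1 - I` is not determined by `V`. The remaining factor `1 - V` is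
  -- nonnegative and comes out by homogeneity.
  have hneg : ∀ n, S.er (fun ω => -Q n ω)
      = -∏ i ∈ Finset.Icc 1 n, (1 - S.er ((X i ⁻¹' B i).indicator fun _ => 1)) := by
    intro n
    induction n with
    | zero => simp [Q, er_const]
    | succ n ih =>
      have hc : S.er (fun ω => -1 + (B (n + 1)).indicator (fun _ => (1 : ℝ)) (X (n + 1) ω))
          = -1 + S.er ((X (n + 1) ⁻¹' B (n + 1)).indicator fun _ => 1) :=
        er_const_add (hI (n + 1) (by omega)) (-1)
      have h1 := hX.er_mul (hQa n) (hQb n) (hQ0 n)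
        (φ := fun x => -1 + (B (n + 1)).indicator (fun _ => 1) x)
        (measurable_const.add (measurable_const.indicator (hB _)))
        ((Bounded.const (-1)).add (hI (n + 1) (by omega)))
      have h2 : 0 ≤ 1 - S.er ((X (n + 1) ⁻¹' B (n + 1)).indicator fun _ => 1) :=
        sub_nonneg.2 (er_le_of_le (hI (n + 1) (by omega)) fun ω => by
          by_cases h : X (n + 1) ω ∈ B (n + 1) <;> simp [h])
      calc S.er (fun ω => -Q (n + 1) ω)
          = S.er (fun ω => Q n ω * (-1 + (B (n + 1)).indicator (fun _ => 1) (X (n + 1) ω))) := by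
            congr 1; funext ω; rw [hsucc]; ring
        _ = S.er (fun ω => (1 - S.er ((X (n + 1) ⁻¹' B (n + 1)).indicator fun _ => 1))
              * -Q n ω) := by
            rw [h1, hc]; congr 1; funext ω; ring
        _ = _ := by
            rw [er_const_mul (hQb n).neg h2, ih, Finset.prod_Icc_succ_top (by omega)]; ring
  have hset : MeasurableSet {ω | ∃ i ∈ Finset.Icc 1 n, X i ω ∈ B i} := by
    have : {ω | ∃ i ∈ Finset.Icc 1 n, X i ω ∈ B i} = ⋃ i ∈ Finset.Icc 1 n, X i ⁻¹' B i := by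
      ext; simp
    rw [this]
    exact Finset.measurableSet_biUnion _ fun i hi => hXm i (Finset.mem_Icc.1 hi).1 (hB i)
  have hind : ({ω | ∃ i ∈ Finset.Icc 1 n, X i ω ∈ B i}.indicator fun _ => (1 : ℝ))
      = fun ω => 1 + -Q n ω := by
    funext ω
    by_cases h : ∃ i ∈ Finset.Icc 1 n, X i ω ∈ B i
    · rw [Set.indicator_of_mem (by exact h)]
      obtain ⟨i, hi, hiB⟩ := h
      have : Q n ω = 0 := Finset.prod_eq_zero hi (by simp [hiB])
      simp [this]
    · rw [Set.indicator_of_notMem (by exact h)]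
      have : Q n ω = 1 := Finset.prod_eq_one fun i hi => by
        have : X i ω ∉ B i := fun hh => h ⟨i, hi, hh⟩
        simp [this]
      simp [this]
  rw [capacity_eq_er hset, hind, er_const_add (hQb n).neg, hneg]
  congr 1

end SublinearExpectationSpace

/-! ### Truncation and an exponential inequality for real numbers. -/

/-- Truncation of a real number at level `δ`. -/
noncomputable def clip (δ x : ℝ) : ℝ := max (min x δ) (-δ)

theorem abs_clip {δ : ℝ} (hδ : 0 ≤ δ) (x : ℝ) : |clip δ x| = min |x| δ := by
  unfold clip
  rcases le_total 0 x with h | h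
  · rw [abs_of_nonneg h, max_eq_left, abs_of_nonneg (le_min h hδ)]
    exact (neg_nonpos.2 hδ).trans (le_min h hδ)
  · rw [abs_of_nonpos h, min_eq_left (h.trans hδ), abs_of_nonpos (max_le h (by linarith)),
      ← min_neg_neg, neg_neg]

theorem clip_of_abs_le {δ x : ℝ} (h : |x| ≤ δ) : clip δ x = x := by
  rw [clip, min_eq_left (abs_le.1 h).2, max_eq_left (abs_le.1 h).1]

theorem abs_clip_sub_le {δ : ℝ} (hδ : 0 ≤ δ) (x : ℝ) : |clip δ x - x| ≤ max (|x| - δ) 0 := by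
  unfold clip
  rcases le_total |x| δ with h | h
  · rw [min_eq_left (abs_le.1 h).2, max_eq_left (abs_le.1 h).1]
    simp
  · rw [max_eq_left (sub_nonneg.2 h)]
    rcases le_total 0 x with h0 | h0
    · rw [abs_of_nonneg h0] at h ⊢
      rw [min_eq_right h, max_eq_left (by linarith), abs_of_nonpos (by linarith)]
      linarith
    · rw [abs_of_nonpos h0] at h ⊢
      rw [min_eq_left (by linarith), max_eq_right (by linarith), abs_of_nonneg (by linarith)]
      linarith

theorem measurable_clip (δ : ℝ) : Measurable (clip δ) :=
  (measurable_id.min measurable_const).max measurable_const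

/-- From `1 - u ≤ exp (-u)` follows `exp u ≤ 1 + u exp u`. It remains to bound `u (exp u - 1)` by
`u² exp L`: use `exp u - 1 ≤ u exp u` if `u ≥ 0`, and `exp u - 1 ≥ u` if `u ≤ 0`. -/
theorem Real.exp_le_one_add_add_sq_mul_exp {u L : ℝ} (h : |u| ≤ L) :
    Real.exp u ≤ 1 + u + u ^ 2 * Real.exp L := by
  have h1 : (1 - u) * Real.exp u ≤ 1 := by
    have := mul_le_mul_of_nonneg_right (Real.add_one_le_exp (-u)) (Real.exp_pos u).le
    rw [← Real.exp_add, neg_add_cancel, Real.exp_zero] at this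
    linarith
  have h2 : Real.exp u ≤ Real.exp L := Real.exp_le_exp.2 ((le_abs_self u).trans h)
  have h3 : 1 ≤ Real.exp L := Real.one_le_exp ((abs_nonneg u).trans h)
  have h4 := Real.add_one_le_exp u
  rcases le_total 0 u with hu | hu
  · have : u * (Real.exp u - 1) ≤ u * (u * Real.exp L) := by
      refine mul_le_mul_of_nonneg_left ?_ hu
      have := mul_le_mul_of_nonneg_left h2 hu
      linarith
    nlinarith
  · have : u ^ 2 ≤ u ^ 2 * Real.exp L := le_mul_of_one_le_right (sq_nonneg u) h3
    nlinarith

/-! ### Moments of truncated variables and the exponential maximal inequality. -/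

namespace SublinearExpectationSpace

variable {Ω : Type*} [MeasurableSpace Ω] {S : SublinearExpectationSpace Ω}

theorem clip_bounded {X : Ω → ℝ} (hX : X ∈ S.H) {δ : ℝ} (hδ : 0 ≤ δ) (a : ℝ) :
    S.Bounded fun ω => clip δ (a * X ω) :=
  ⟨max_const_mem (min_const_mem (const_mul_mem hX a) δ) (-δ), δ, fun ω => by
    rw [abs_clip hδ]; exact min_le_right _ _⟩

theorem IdentDistributed.er_eq {X Y : Ω → ℝ}
    (h : IdentDistributed S S (fun _ : Fin 1 => X) (fun _ : Fin 1 => Y)) {φ : ℝ → ℝ}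
    (hφ : Measurable φ) (hX : S.Bounded fun ω => φ (X ω)) (hY : S.Bounded fun ω => φ (Y ω)) :
    S.er (fun ω => φ (X ω)) = S.er fun ω => φ (Y ω) :=
  congrArg EReal.toReal <| h (fun x => φ (x 0)) (hφ.comp (measurable_pi_apply 0)) hX.1 hY.1
    (by rw [← hX.coe_er]; simp) (by rw [← hX.coe_er]; simp)
    (by rw [← hY.coe_er]; simp) (by rw [← hY.coe_er]; simp)

section Moments

variable {X : Ω → ℝ} {K q : ℝ}

/-- Cut the range `(0, δ]` of the truncated variable into the dyadic layers `(δ 2^(-k-1), δ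
2^(-k)]`. The tail bound makes the `k`-th layer contribute `a^q` times a geometric term of ratio
`2^(q-θ)`, which is less than one as `q < θ`. -/
theorem CountablySubadditive.exists_er_truncated_pow_le (hS : S.CountablySubadditive)
    (hX : X ∈ S.H) (hg : ∀ t, 0 < t → S.er ({ω | t < |X ω|}.indicator fun _ => 1) ≤ K * t ^ (-q))
    {δ : ℝ} (hδ : 0 < δ) {θ : ℕ} (hθ0 : θ ≠ 0) (hθ : q < θ) :
    ∃ C : ℝ, ∀ a : ℝ, 0 < a → S.er (fun ω => |clip δ (a * X ω)| ^ θ) ≤ C * a ^ q := by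
  have hXm := S.measurable_of_mem X hX
  set ρ : ℝ := 2 ^ (q - θ) with hρ
  have hρ0 : 0 < ρ := by positivity
  have hρ1 : ρ < 1 := Real.rpow_lt_one_of_one_lt_of_neg one_lt_two (by linarith)
  refine ⟨K * δ ^ (θ - q) * 2 ^ q * (1 - ρ)⁻¹, fun a ha => ?_⟩
  have hb := clip_bounded (S := S) hX hδ.le a
  have hpow : ∀ n : ℕ, S.Bounded fun ω => |clip δ (a * X ω)| ^ n := by
    intro n
    induction n with
    | zero => simpa using Bounded.const 1
    | succ n ih => simpa [pow_succ] using ih.mul hb.abs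
  have hterm : ∀ k : ℕ, (δ * (1 / 2) ^ k) ^ θ * (K * (δ * (1 / 2) ^ (k + 1) / a) ^ (-q))
      = K * δ ^ (θ - q) * 2 ^ q * a ^ q * ρ ^ k := by
    intro k
    have e1 : ((1 : ℝ) / 2) ^ k = 2 ^ (-(k : ℝ)) := by
      rw [Real.rpow_neg two_pos.le, Real.rpow_natCast, one_div, inv_pow]
    have e2 : ((1 : ℝ) / 2) ^ (k + 1) = 2 ^ (-(k : ℝ) - 1) := by
      rw [pow_succ, e1, Real.rpow_sub_one two_ne_zero]; ring
    rw [e1, e2, hρ, ← Real.rpow_natCast (2 ^ (q - (θ : ℝ))) k, ← Real.rpow_natCast _ θ,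
      Real.mul_rpow hδ.le (by positivity), Real.div_rpow (by positivity) ha.le,
      Real.mul_rpow hδ.le (by positivity), ← Real.rpow_mul two_pos.le, ← Real.rpow_mul two_pos.le,
      ← Real.rpow_mul two_pos.le, Real.rpow_neg ha.le, div_inv_eq_mul]
    have e3 : δ ^ ((θ : ℝ) - q) = δ ^ (θ : ℝ) * δ ^ (-q) := by
      rw [← Real.rpow_add hδ]; ring_nf
    have e4 : (2 : ℝ) ^ q * 2 ^ ((q - θ) * (k : ℝ))
        = 2 ^ (-(k : ℝ) * θ) * 2 ^ ((-(k : ℝ) - 1) * -q) := by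
      rw [← Real.rpow_add two_pos, ← Real.rpow_add two_pos]; ring_nf
    rw [e3]
    linear_combination (-K * δ ^ (θ : ℝ) * δ ^ (-q) * a ^ q) * e4
  have key := hS.er_le_tsum (hpow θ) (fun ω => by positivity) (c := fun k => (δ * (1 / 2) ^ k) ^ θ)
    (fun k => by positivity) (A := fun k => {ω | δ * (1 / 2) ^ (k + 1) / a < |X ω|})
    (fun k => measurableSet_lt measurable_const hXm.abs)
    (b := fun k => K * (δ * (1 / 2) ^ (k + 1) / a) ^ (-q))
    (fun k => hg _ (by positivity))
    (by
      simp only [hterm]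
      exact (summable_geometric_of_lt_one hρ0.le hρ1).mul_left _)
    (fun ω hω => by
      have hmin := abs_clip hδ.le (a * X ω)
      have hpos : 0 < |clip δ (a * X ω)| := by
        rcases (abs_nonneg (clip δ (a * X ω))).eq_or_lt with h | h
        · rw [← h] at hω
          simp [hθ0] at hω
        · exact h
      obtain ⟨k, hk1, hk2⟩ := exists_nat_pow_near_of_lt_one (x := |clip δ (a * X ω)| / δ)
        (y := (1 / 2 : ℝ)) (by positivity)
        (by rw [div_le_one hδ, hmin]; exact min_le_right _ _) (by norm_num) (by norm_num)
      refine ⟨k, ?_, ?_⟩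
      · rw [lt_div_iff₀ hδ, hmin] at hk1
        rw [Set.mem_ofPred_eq, div_lt_iff₀ ha]
        have := lt_of_lt_of_le hk1 (min_le_left _ _)
        rw [abs_mul, abs_of_pos ha] at this
        linarith
      · rw [div_le_iff₀ hδ] at hk2
        gcongr
        linarith)
  refine key.trans (le_of_eq ?_)
  simp only [hterm]
  rw [tsum_mul_left, tsum_geometric_of_lt_one hρ0.le hρ1]
  ring

/-- Here the layers go upwards from `δ`, and the ratio `2^(1-q)` is less than one because `q > 1`.
The excess need not be bounded, so the estimate is stated for `S.E` itself. -/
theorem CountablySubadditive.exists_expectation_excess_le (hS : S.CountablySubadditive)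
    (hX : X ∈ S.H) (hg : ∀ t, 0 < t → S.er ({ω | t < |X ω|}.indicator fun _ => 1) ≤ K * t ^ (-q))
    {δ : ℝ} (hδ : 0 < δ) (hq : 1 < q) :
    ∃ C : ℝ, ∀ a : ℝ, 0 < a →
      S.E (fun ω => max (|a * X ω| - δ) 0) ≤ ((C * a ^ q : ℝ) : EReal) := by
  have hXm := S.measurable_of_mem X hX
  set ρ : ℝ := 2 ^ (1 - q) with hρ
  have hρ0 : 0 < ρ := by positivity
  have hρ1 : ρ < 1 := Real.rpow_lt_one_of_one_lt_of_neg one_lt_two (by linarith)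
  refine ⟨2 * K * δ ^ (1 - q) * 2 ^ q * (1 - ρ)⁻¹, fun a ha => ?_⟩
  have hterm : ∀ k : ℕ, (δ * 2 ^ (k + 1)) * (K * (δ * 2 ^ k / 2 / a) ^ (-q))
      = 2 * K * δ ^ (1 - q) * 2 ^ q * a ^ q * ρ ^ k := by
    intro k
    have e1 : (2 : ℝ) ^ k = 2 ^ (k : ℝ) := (Real.rpow_natCast 2 k).symm
    rw [pow_succ, e1, hρ, ← Real.rpow_natCast (2 ^ (1 - q)) k,
      Real.div_rpow (by positivity) ha.le, Real.div_rpow (by positivity) two_pos.le,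
      Real.mul_rpow hδ.le (by positivity), ← Real.rpow_mul two_pos.le, ← Real.rpow_mul two_pos.le,
      Real.rpow_neg ha.le, div_inv_eq_mul, Real.rpow_neg two_pos.le q, div_inv_eq_mul]
    have e3 : δ ^ (1 - q) = δ * δ ^ (-q) := by
      nth_rewrite 2 [← Real.rpow_one δ]
      rw [← Real.rpow_add hδ]; ring_nf
    have e4 : (2 : ℝ) ^ ((1 - q) * (k : ℝ)) = 2 ^ (k : ℝ) * 2 ^ ((k : ℝ) * -q) := by
      rw [← Real.rpow_add two_pos]; ring_nf
    rw [e3, e4]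
    ring
  have hmem : (fun ω => max (|a * X ω| - δ) 0) ∈ S.H := by
    have := add_mem (abs_mem (const_mul_mem hX a)) (const_mem (-δ))
    simpa [sub_eq_add_neg] using max_const_mem this 0
  -- The lower end of the layer is halved so that the weak inequality `δ 2^k ≤ |a X|` yields the
  -- strict one in the tail event.
  have key := hS.le_tsum hmem (fun ω => le_max_right _ _) (c := fun k => δ * 2 ^ (k + 1))
    (fun k => by positivity) (A := fun k => {ω | δ * 2 ^ k / 2 / a < |X ω|})
    (fun k => measurableSet_lt measurable_const hXm.abs)
    (b := fun k => K * (δ * 2 ^ k / 2 / a) ^ (-q))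
    (fun k => hg _ (by positivity))
    (by
      simp only [hterm]
      exact (summable_geometric_of_lt_one hρ0.le hρ1).mul_left _)
    (fun ω hω => by
      have h1 : δ < |a * X ω| := by
        rcases lt_max_iff.1 hω with h | h
        · linarith
        · exact absurd h (lt_irrefl 0)
      obtain ⟨k, hk1, hk2⟩ := exists_nat_pow_near (x := |a * X ω| / δ)
        (y := (2 : ℝ)) (by rw [one_le_div hδ]; exact h1.le) one_lt_two
      refine ⟨k, ?_, ?_⟩
      · rw [le_div_iff₀ hδ, abs_mul, abs_of_pos ha] at hk1
        rw [Set.mem_ofPred_eq, div_lt_iff₀ ha]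
        have : 0 < δ * 2 ^ k := by positivity
        linarith
      · rw [div_lt_iff₀ hδ] at hk2
        refine max_le ?_ (by positivity)
        linarith)
  refine key.trans (le_of_eq ?_)
  simp only [hterm]
  rw [tsum_mul_left, tsum_geometric_of_lt_one hρ0.le hρ1]
  congr 1
  ring

/-- The expectation of truncated variables is small, when the mean is certainly zero. -/
theorem CountablySubadditive.exists_er_clip_le (hS : S.CountablySubadditive)
    (hX : X ∈ S.H) (hg : ∀ t, 0 < t → S.er ({ω | t < |X ω|}.indicator fun _ => 1) ≤ K * t ^ (-q))
    {δ : ℝ} (hδ : 0 < δ)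
    (hq : q < 1 ∨ 1 < q ∧ S.E X = 0 ∧ S.E (fun ω => -X ω) = 0) {s : ℝ} (hs : s = 1 ∨ s = -1) :
    ∃ C : ℝ, ∀ a : ℝ, 0 < a → S.er (fun ω => s * clip δ (a * X ω)) ≤ C * a ^ q := by
  rcases hq with hq | ⟨hq, h1, h2⟩
  · obtain ⟨C, hC⟩ := hS.exists_er_truncated_pow_le hX hg hδ one_ne_zero (by simpa using hq)
    refine ⟨C, fun a ha => le_trans ?_ (hC a ha)⟩
    have hb := clip_bounded (S := S) hX hδ.le a
    simp only [pow_one]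
    refine er_mono (hb.const_mul s) hb.abs fun ω => ?_
    rcases hs with rfl | rfl
    · simpa using le_abs_self _
    · simpa using neg_le_abs _
  · obtain ⟨C, hC⟩ := hS.exists_expectation_excess_le hX hg hδ hq
    refine ⟨C, fun a ha => ?_⟩
    have hb := (clip_bounded (S := S) hX hδ.le a).const_mul s
    -- The truncated variable is at most the untruncated one plus the excess. The former has
    -- expectation zero for both signs, so only the excess contributes.
    have hEs : S.E (fun ω => a * (s * X ω)) = 0 := by
      rw [S.pos_homogeneous _ (const_mul_mem hX s) a ha.le]
      rcases hs with rfl | rfl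
      · simp [h1]
      · simp [h2]
    have hmem : (fun ω => max (|a * X ω| - δ) 0) ∈ S.H := by
      have := add_mem (abs_mem (const_mul_mem hX a)) (const_mem (-δ))
      simpa [sub_eq_add_neg] using max_const_mem this 0
    have hXs := const_mul_mem (const_mul_mem hX s) a
    have hadd := S.subadditive _ hXs _ hmem (by rw [hEs]; simp) (by rw [hEs]; simp)
    rw [hEs, zero_add] at hadd
    have hle := S.mono _ (add_mem hXs hmem) _ hb.1 (fun ω => by
      have := abs_le.1 (abs_clip_sub_le hδ.le (a * X ω))
      rcases hs with rfl | rfl <;> linarith)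
    have := (hle.trans hadd).trans (hC a ha)
    rw [← hb.coe_er] at this
    exact_mod_cast this

end Moments

/-- Exponential maximal inequality for sums of truncated independent variables. -/
theorem IndepSeq.capacity_exists_lt_sum_clip_le {X : ℕ → Ω → ℝ} (hX : S.IndepSeq X)
    (hXH : ∀ i, 1 ≤ i → X i ∈ S.H) {s : ℝ} (hs : s = 1 ∨ s = -1) {δ : ℝ} (hδ : 0 ≤ δ) {α : ℕ → ℝ}
    {m v : ℕ → ℝ} (hm0 : ∀ i, 0 ≤ m i) (hv0 : ∀ i, 0 ≤ v i)
    (hm : ∀ i, 1 ≤ i → S.er (fun ω => s * clip δ (α i * X i ω)) ≤ m i)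
    (hv : ∀ i, 1 ≤ i → S.er (fun ω => |clip δ (α i * X i ω)| ^ 2) ≤ v i) {l : ℝ} (hl : 0 < l)
    (ε : ℝ) (n : ℕ) :
    S.capacity {ω | ∃ j ≤ n, ε < ∑ i ∈ Finset.Icc 1 j, s * clip δ (α i * X i ω)}
      ≤ ENNReal.ofReal (Real.exp (-(l * ε) + ∑ i ∈ Finset.Icc 1 n,
          (l * m i + l ^ 2 * Real.exp (l * δ) * v i))) := by
  set κ := l ^ 2 * Real.exp (l * δ)
  have hκ : 0 ≤ κ := by positivity
  have hexp : ∀ y : ℝ, Real.exp (l * (s * clip δ y))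
      ≤ 1 + l * (s * clip δ y) + κ * |clip δ y| ^ 2 := by
    intro y
    have hs1 : |s| = 1 := by rcases hs with rfl | rfl <;> simp
    have hu : |l * (s * clip δ y)| ≤ l * δ := by
      rw [abs_mul, abs_mul, abs_of_pos hl, hs1, one_mul, abs_clip hδ]
      exact mul_le_mul_of_nonneg_left (min_le_right _ _) hl.le
    have hs2 : s ^ 2 = 1 := by rcases hs with rfl | rfl <;> norm_num
    refine (Real.exp_le_one_add_add_sq_mul_exp hu).trans (le_of_eq ?_)
    rw [mul_pow, mul_pow, hs2, sq_abs]
    ring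
  -- The quadratic majorant of the exponential needs only the two moments that are controlled. Its
  -- expectation is at most `1 + l m + κ v ≤ exp (l m + κ v)`, so the prefactor normalizes it to at
  -- most one.
  let D : ℕ → ℝ → ℝ := fun i x => Real.exp (-(l * m i + κ * v i))
    * (1 + (l * (s * clip δ (α i * x)) + κ * |clip δ (α i * x)| ^ 2))
  have hDexp : ∀ i x, Real.exp (-(l * m i + κ * v i) + l * (s * clip δ (α i * x))) ≤ D i x := by
    intro i x
    rw [Real.exp_add]
    refine mul_le_mul_of_nonneg_left ?_ (Real.exp_pos _).le
    rw [← add_assoc]; exact hexp _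
  have hD0 : ∀ i x, 0 ≤ D i x := fun i x => (Real.exp_pos _).le.trans (hDexp i x)
  have hDm : ∀ i, Measurable (D i) := by
    intro i
    have h1 : Measurable fun x : ℝ => clip δ (α i * x) :=
      (measurable_clip δ).comp (measurable_const.mul measurable_id)
    exact measurable_const.mul (measurable_const.add
      ((measurable_const.mul (measurable_const.mul h1)).add
        (measurable_const.mul (h1.abs.pow_const 2))))
  have hcb : ∀ i, 1 ≤ i → S.Bounded fun ω => clip δ (α i * X i ω) :=
    fun i hi => clip_bounded (hXH i hi) hδ _
  have hb1 : ∀ i, 1 ≤ i → S.Bounded fun ω => l * (s * clip δ (α i * X i ω)) :=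
    fun i hi => ((hcb i hi).const_mul s).const_mul l
  have hb2' : ∀ i, 1 ≤ i → S.Bounded fun ω => |clip δ (α i * X i ω)| ^ 2 :=
    fun i hi => by simpa [sq] using (hcb i hi).mul (hcb i hi)
  have hb2 : ∀ i, 1 ≤ i → S.Bounded fun ω => κ * |clip δ (α i * X i ω)| ^ 2 :=
    fun i hi => (hb2' i hi).const_mul κ
  have hDX : ∀ i, 1 ≤ i → S.Bounded fun ω => D i (X i ω) := fun i hi =>
    ((Bounded.const 1).add ((hb1 i hi).add (hb2 i hi))).const_mul _
  have hE : ∀ i, 1 ≤ i → S.er (fun ω => D i (X i ω)) ≤ 1 := by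
    intro i hi
    have h1 := er_const_mul ((Bounded.const 1).add ((hb1 i hi).add (hb2 i hi)))
      (Real.exp_pos (-(l * m i + κ * v i))).le
    have h2 := er_const_add ((hb1 i hi).add (hb2 i hi)) 1
    have h3 := er_add_le (hb1 i hi) (hb2 i hi)
    rw [er_const_mul ((hcb i hi).const_mul s) hl.le, er_const_mul (hb2' i hi) hκ] at h3
    have h4 := mul_le_mul_of_nonneg_left (hm i hi) hl.le
    have h5 := mul_le_mul_of_nonneg_left (hv i hi) hκ
    calc S.er (fun ω => D i (X i ω))
        = Real.exp (-(l * m i + κ * v i)) * (1 + S.er (fun ω => l * (s * clip δ (α i * X i ω))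
            + κ * |clip δ (α i * X i ω)| ^ 2)) := by rw [← h2]; exact h1
      _ ≤ Real.exp (-(l * m i + κ * v i)) * Real.exp (l * m i + κ * v i) := by
          refine mul_le_mul_of_nonneg_left ?_ (Real.exp_pos _).le
          linarith [Real.add_one_le_exp (l * m i + κ * v i)]
      _ = 1 := by rw [← Real.exp_add]; simp
  set M := ∑ i ∈ Finset.Icc 1 n, (l * m i + κ * v i)
  have key := hX.capacity_exists_lt_prod_le hDm hD0 hDX hE (Real.exp_pos (l * ε - M)) n
  rw [← Real.exp_neg] at key
  have hrw : -(l * ε - M) = -(l * ε) + M := by ring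
  rw [hrw] at key
  refine le_trans (capacity_mono ?_) key
  rintro ω ⟨j, hj, hlt⟩
  refine ⟨j, hj, ?_⟩
  -- Nonnegativity of `m` and `v` lets the full compensator `M` replace that of each shorter partial
  -- sum, so one level serves for all `j`.
  have hM : ∑ i ∈ Finset.Icc 1 j, (l * m i + κ * v i) ≤ M :=
    Finset.sum_le_sum_of_subset_of_nonneg (Finset.Icc_subset_Icc_right hj)
      fun i _ _ => add_nonneg (mul_nonneg hl.le (hm0 i)) (mul_nonneg hκ (hv0 i))
  calc Real.exp (l * ε - M)
      < Real.exp (∑ i ∈ Finset.Icc 1 j,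
          (-(l * m i + κ * v i) + l * (s * clip δ (α i * X i ω)))) := by
        rw [Real.exp_lt_exp, Finset.sum_add_distrib, Finset.sum_neg_distrib, ← Finset.mul_sum]
        have := mul_lt_mul_of_pos_left hlt hl
        linarith
    _ = ∏ i ∈ Finset.Icc 1 j, Real.exp (-(l * m i + κ * v i) + l * (s * clip δ (α i * X i ω))) :=
        Real.exp_sum _ _
    _ ≤ ∏ i ∈ Finset.Icc 1 j, D i (X i ω) :=
        Finset.prod_le_prod (fun _ _ => (Real.exp_pos _).le) fun i _ => hDexp i _

end SublinearExpectationSpace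

/-! ### Power sums over integers. -/

section PowerSums

/-- For `α ≥ 0` every term is at most the last. For `α ≤ 0` Bernoulli's inequality with the exponent
`α + 1 ∈ (0, 1]` gives `N^(α+1) + (α+1)(N+1)^α ≤ (N+1)^(α+1)`, which drives an induction. -/
theorem exists_sum_Icc_rpow_le {α : ℝ} (hα : -1 < α) :
    ∃ C : ℝ, 0 < C ∧ ∀ x : ℝ, 0 ≤ x →
      ∑ n ∈ Finset.Icc 1 ⌊x⌋₊, (n : ℝ) ^ α ≤ C * x ^ (α + 1) := by
  suffices h : ∃ C : ℝ, 0 < C ∧ ∀ N : ℕ,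
      ∑ n ∈ Finset.Icc 1 N, (n : ℝ) ^ α ≤ C * (N : ℝ) ^ (α + 1) by
    obtain ⟨C, hC, h⟩ := h
    refine ⟨C, hC, fun x hx => (h _).trans ?_⟩
    gcongr
    · linarith
    · exact Nat.floor_le hx
  rcases le_total 0 α with h0 | h0
  · refine ⟨1, one_pos, fun N => ?_⟩
    rcases Nat.eq_zero_or_pos N with rfl | hN
    · simp; positivity
    · calc ∑ n ∈ Finset.Icc 1 N, (n : ℝ) ^ α ≤ ∑ n ∈ Finset.Icc 1 N, (N : ℝ) ^ α := by
            refine Finset.sum_le_sum fun n hn => ?_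
            gcongr
            exact (Finset.mem_Icc.1 hn).2
        _ = 1 * (N : ℝ) ^ (α + 1) := by
            rw [Real.rpow_add_one (by positivity)]
            simp [mul_comm]
  · have hα1 : 0 < α + 1 := by linarith
    refine ⟨(α + 1)⁻¹, by positivity, fun N => ?_⟩
    induction N with
    | zero => simp [Real.zero_rpow hα1.ne']
    | succ N ih =>
      rw [Finset.sum_Icc_succ_top (by omega)]
      refine (add_le_add_left ih _).trans ?_
      rw [inv_mul_eq_div, inv_mul_eq_div, div_add' _ _ _ hα1.ne', div_le_div_iff_of_pos_right hα1]
      have ht : (0 : ℝ) < (N : ℝ) + 1 := by positivity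
      push_cast
      have h1 : (N : ℝ) = (N + 1) * (1 + -(1 / (N + 1 : ℝ))) := by field_simp; ring
      have h2 : (-1 : ℝ) ≤ -(1 / (N + 1 : ℝ)) := by
        rw [neg_le_neg_iff, div_le_one ht]; linarith [Nat.cast_nonneg (α := ℝ) N]
      have h3 := rpow_one_add_le_one_add_mul_self h2 hα1.le (by linarith)
      have h4 : (N : ℝ) ^ (α + 1) ≤ (N + 1 : ℝ) ^ (α + 1) * (1 + (α + 1) * -(1 / (N + 1 : ℝ))) := by
        conv_lhs => rw [h1]
        rw [Real.mul_rpow ht.le (by linarith)]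
        gcongr
      have h5 : (N + 1 : ℝ) ^ (α + 1) * (1 + (α + 1) * -(1 / (N + 1 : ℝ)))
          = (N + 1 : ℝ) ^ (α + 1) - (α + 1) * (N + 1 : ℝ) ^ α := by
        rw [Real.rpow_add_one ht.ne']; field_simp; ring
      linarith

/-- The terms with `x/2 < n ≤ x` suffice: each is at least `2^(-|α|) x^α`, and since `x ≥ 2` there
are at least `x/4` of them. The condition `2 i ≤ x` keeps them all in the range of summation. -/
theorem exists_le_sum_Icc_rpow (α : ℝ) :
    ∃ c : ℝ, 0 < c ∧ ∀ (x : ℝ) (i : ℕ), 1 ≤ i → 2 * (i : ℝ) ≤ x →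
      c * x ^ (α + 1) ≤ ∑ n ∈ Finset.Icc i ⌊x⌋₊, (n : ℝ) ^ α := by
  refine ⟨2 ^ (-|α|) / 4, by positivity, fun x i hi hx => ?_⟩
  have hi' : (1 : ℝ) ≤ i := by exact_mod_cast hi
  have hx0 : 0 < x := by linarith
  have hsub : Finset.Ioc ⌊x / 2⌋₊ ⌊x⌋₊ ⊆ Finset.Icc i ⌊x⌋₊ := by
    intro n hn
    rw [Finset.mem_Ioc] at hn
    refine Finset.mem_Icc.2 ⟨?_, hn.2⟩
    have : i ≤ ⌊x / 2⌋₊ := Nat.le_floor (by linarith)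
    omega
  have hcard : x / 4 ≤ ((Finset.Ioc ⌊x / 2⌋₊ ⌊x⌋₊).card : ℝ) := by
    rw [Nat.card_Ioc]
    have h1 : ⌊x / 2⌋₊ ≤ ⌊x⌋₊ := Nat.floor_mono (by linarith)
    have h2 := Nat.lt_floor_add_one x
    have h3 := Nat.floor_le (a := x / 2) (by positivity)
    rcases le_total 4 x with h4 | h4
    · rw [Nat.cast_sub h1]; linarith
    · have h5 : ⌊x / 2⌋₊ < ⌊x⌋₊ := by
        have : (⌊x / 2⌋₊ : ℝ) < ⌊x⌋₊ + 0 := by linarith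
        exact_mod_cast (by simpa using this)
      have h6 : (1 : ℝ) ≤ ((⌊x⌋₊ - ⌊x / 2⌋₊ : ℕ) : ℝ) := by
        exact_mod_cast (by omega : 1 ≤ ⌊x⌋₊ - ⌊x / 2⌋₊)
      linarith
  have hterm : ∀ n ∈ Finset.Ioc ⌊x / 2⌋₊ ⌊x⌋₊, 2 ^ (-|α|) * x ^ α ≤ (n : ℝ) ^ α := by
    intro n hn
    rw [Finset.mem_Ioc] at hn
    have h1 : x / 2 ≤ n := (Nat.lt_of_floor_lt hn.1).le
    have h2 : (n : ℝ) ≤ x := (Nat.le_floor_iff hx0.le).1 hn.2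
    rcases le_total 0 α with h0 | h0
    · rw [abs_of_nonneg h0, Real.rpow_neg two_pos.le, inv_mul_eq_div,
        ← Real.div_rpow hx0.le two_pos.le]
      gcongr
    · have h3 : (2 : ℝ) ^ (-|α|) ≤ 1 := Real.rpow_le_one_of_one_le_of_nonpos one_le_two (by simp)
      have h4 : x ^ α ≤ (n : ℝ) ^ α := Real.rpow_le_rpow_of_nonpos (by linarith) h2 h0
      exact (mul_le_of_le_one_left (by positivity) h3).trans h4
  calc 2 ^ (-|α|) / 4 * x ^ (α + 1) = x / 4 * (2 ^ (-|α|) * x ^ α) := by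
        rw [Real.rpow_add_one hx0.ne']; ring
    _ ≤ ((Finset.Ioc ⌊x / 2⌋₊ ⌊x⌋₊).card : ℝ) * (2 ^ (-|α|) * x ^ α) := by gcongr
    _ ≤ ∑ n ∈ Finset.Ioc ⌊x / 2⌋₊ ⌊x⌋₊, (n : ℝ) ^ α := by
        rw [← nsmul_eq_mul]; exact Finset.card_nsmul_le_sum _ _ _ hterm
    _ ≤ _ := Finset.sum_le_sum_of_subset_of_nonneg hsub fun _ _ _ => by positivity

end PowerSums

/-! ### Growth of the counting function in the three regimes. -/

/-- The order of growth of the number of atoms below `T`. -/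
noncomputable def growthSum (r p β d T : ℝ) : ℝ :=
  T ^ ((r - 1) / (p + β)) * ∑ i ∈ Finset.Icc 1 ⌊(T / d) ^ (1 / p)⌋₊, (i : ℝ) ^ (β * ((r - 1) / (p + β)))

/-- `f` and `growthSum` are comparable up to constants. -/
def GrowthComparable (r p β : ℝ) (f : ℝ → ℝ) : Prop :=
  ∀ d : ℝ, 0 < d → (∃ C : ℝ, 0 ≤ C ∧ ∀ T, 0 < T → growthSum r p β d T ≤ C * (f T + 1)) ∧
    ∃ C : ℝ, 0 ≤ C ∧ ∀ T, 0 < T → f T ≤ C * (growthSum r p β d T + 1)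

theorem growthSum_nonneg {r p β d T : ℝ} (hT : 0 < T) : 0 ≤ growthSum r p β d T :=
  mul_nonneg (by positivity) (Finset.sum_nonneg fun _ _ => by positivity)

/-- It suffices to compare from below at large arguments. -/
theorem exists_le_growthSum {r p β d : ℝ} {f : ℝ → ℝ} (hf : MonotoneOn f (Set.Ici 0))
    (hf0 : ∀ x, 0 ≤ x → 0 ≤ f x) {C T₀ : ℝ} (hC : 0 ≤ C) (hT₀ : 0 ≤ T₀)
    (h : ∀ T, 0 < T → T₀ ≤ T → f T ≤ C * growthSum r p β d T) :
    ∃ C : ℝ, 0 ≤ C ∧ ∀ T, 0 < T → f T ≤ C * (growthSum r p β d T + 1) := by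
  refine ⟨max C (f T₀), le_max_of_le_left hC, fun T hT => ?_⟩
  have hg := growthSum_nonneg (r := r) (p := p) (β := β) (d := d) hT
  rcases le_total T₀ T with h1 | h1
  · refine (h T hT h1).trans ?_
    gcongr
    · exact le_max_left _ _
    · linarith
  · have h2 : f T ≤ f T₀ := hf hT.le hT₀ h1
    have h3 : f T₀ ≤ max C (f T₀) := le_max_right _ _
    have h4 := hf0 T₀ hT₀
    nlinarith

section Growth

variable {r p β : ℝ}

/-- The exponent of `i` is less than `-1`, so the inner sum stays below a convergent series; it is
at least its first term, present as soon as `T ≥ d`. -/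
theorem growthComparable_of_lt (hr : 1 < r) (hp : 0 < p) (hβ : 0 < β + p) (h : β < -p / r) :
    GrowthComparable r p β fun x => x ^ ((r - 1) / (p + β)) := by
  have hpb : 0 < p + β := by linarith
  have hr0 : 0 < r := by linarith
  have hγ : β * ((r - 1) / (p + β)) < -1 := by
    rw [lt_div_iff₀ hr0] at h
    rw [← mul_div_assoc, div_lt_iff₀ hpb]
    nlinarith
  set γ := β * ((r - 1) / (p + β)) with hγdef
  have hs : 0 < (r - 1) / (p + β) := div_pos (by linarith) hpb
  have hsum : Summable fun n : ℕ => (n : ℝ) ^ γ := Real.summable_nat_rpow.2 hγ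
  refine fun d hd => ⟨⟨∑' n : ℕ, (n : ℝ) ^ γ, tsum_nonneg fun _ => by positivity, fun T hT => ?_⟩, ?_⟩
  · have h1 : ∑ i ∈ Finset.Icc 1 ⌊(T / d) ^ (1 / p)⌋₊, (i : ℝ) ^ γ ≤ ∑' n : ℕ, (n : ℝ) ^ γ :=
      hsum.sum_le_tsum _ fun _ _ => by positivity
    have h2 : 0 ≤ T ^ ((r - 1) / (p + β)) := by positivity
    have h3 : 0 ≤ ∑' n : ℕ, (n : ℝ) ^ γ := tsum_nonneg fun _ => by positivity
    rw [growthSum, ← hγdef]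
    calc _ ≤ T ^ ((r - 1) / (p + β)) * ∑' n : ℕ, (n : ℝ) ^ γ := by gcongr
      _ ≤ _ := by nlinarith
  · refine exists_le_growthSum (C := 1) (T₀ := d) (fun x hx y _ hxy => ?_)
      (fun x hx => by positivity) zero_le_one hd.le (fun T hT hdT => ?_)
    · exact Real.rpow_le_rpow hx hxy hs.le
    · rw [growthSum, one_mul, ← hγdef]
      refine le_mul_of_one_le_right (by positivity) ?_
      have h1 : 1 ≤ (T / d) ^ (1 / p) :=
        Real.one_le_rpow ((one_le_div hd).2 hdT) (by positivity)
      have h2 : 1 ∈ Finset.Icc 1 ⌊(T / d) ^ (1 / p)⌋₊ :=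
        Finset.mem_Icc.2 ⟨le_rfl, Nat.le_floor (by simpa using h1)⟩
      simpa using Finset.single_le_sum (f := fun i : ℕ => (i : ℝ) ^ γ)
        (fun i _ => by positivity) h2

/-- The exponent `γ` of `i` exceeds `-1`, so the inner sum is of order `T^((γ+1)/p)`; the two
exponents of `T` add up to `r/p`. -/
theorem growthComparable_of_gt (hr : 1 < r) (hp : 0 < p) (hβ : 0 < β + p) (h : -p / r < β) :
    GrowthComparable r p β fun x => x ^ (r / p) := by
  have hpb : 0 < p + β := by linarith
  have hr0 : 0 < r := by linarith
  have hγ : -1 < β * ((r - 1) / (p + β)) := by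
    rw [div_lt_iff₀ hr0] at h
    rw [← mul_div_assoc, lt_div_iff₀ hpb]
    nlinarith
  have hid : (r - 1) / (p + β) + (1 / p) * (β * ((r - 1) / (p + β)) + 1) = r / p := by
    field_simp
    ring
  set γ := β * ((r - 1) / (p + β)) with hγdef
  have hD : ∀ d T : ℝ, 0 < d → 0 < T →
      T ^ ((r - 1) / (p + β)) * ((T / d) ^ (1 / p)) ^ (γ + 1)
        = (d ^ ((1 / p) * (γ + 1)))⁻¹ * T ^ (r / p) := by
    intro d T hd hT
    rw [← Real.rpow_mul (by positivity), Real.div_rpow hT.le hd.le, ← hid, Real.rpow_add hT]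
    ring
  obtain ⟨C, hC, hCle⟩ := exists_sum_Icc_rpow_le hγ
  obtain ⟨c, hc, hcle⟩ := exists_le_sum_Icc_rpow γ
  refine fun d hd => ⟨⟨C * (d ^ ((1 / p) * (γ + 1)))⁻¹, by positivity, fun T hT => ?_⟩, ?_⟩
  · rw [growthSum, ← hγdef]
    calc _ ≤ T ^ ((r - 1) / (p + β)) * (C * ((T / d) ^ (1 / p)) ^ (γ + 1)) := by
          gcongr
          exact hCle _ (by positivity)
      _ = C * (d ^ ((1 / p) * (γ + 1)))⁻¹ * T ^ (r / p) := by
          rw [mul_left_comm, hD d T hd hT]; ring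
      _ ≤ _ := by gcongr; linarith
  · refine exists_le_growthSum (C := d ^ ((1 / p) * (γ + 1)) * c⁻¹) (T₀ := d * 2 ^ p)
      (fun x hx y _ hxy => ?_)
      (fun x hx => by positivity) (by positivity) (by positivity) (fun T hT hdT => ?_)
    · exact Real.rpow_le_rpow hx hxy (by positivity)
    · have h2 : 2 ≤ (T / d) ^ (1 / p) := by
        have : (2 : ℝ) = (2 ^ p) ^ (1 / p) := by
          rw [← Real.rpow_mul two_pos.le, mul_one_div_cancel hp.ne', Real.rpow_one]
        rw [this]
        gcongr
        rw [le_div_iff₀ hd]; linarith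
      have h3 := hcle ((T / d) ^ (1 / p)) 1 le_rfl (by simpa using h2)
      rw [growthSum, ← hγdef]
      calc T ^ (r / p) = d ^ ((1 / p) * (γ + 1)) * c⁻¹ *
            (T ^ ((r - 1) / (p + β)) * (c * ((T / d) ^ (1 / p)) ^ (γ + 1))) := by
            rw [mul_left_comm (T ^ _) c, hD d T hd hT]
            field_simp
        _ ≤ _ := by gcongr

/-- In the critical case the exponent of `i` is exactly `-1` and that of `T` is `r/p`; the inner sum
is harmonic, hence the logarithm. -/
theorem growthComparable_of_eq (hr : 1 < r) (hp : 0 < p) (h : β = -p / r) :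
    GrowthComparable r p β fun x => x ^ (r / p) * Real.log (1 + x) := by
  have hr0 : 0 < r := by linarith
  have hs : (r - 1) / (p + β) = r / p := by
    have h1 : p + β = p * (r - 1) / r := by rw [h]; field_simp; ring
    have h2 : r - 1 ≠ 0 := by linarith
    rw [h1]; field_simp
  have hγ : β * (r / p) = -1 := by rw [h]; field_simp
  have hrp : 0 < r / p := by positivity
  have hG : ∀ d T : ℝ, growthSum r p β d T
      = T ^ (r / p) * (harmonic ⌊(T / d) ^ (1 / p)⌋₊ : ℝ) := by
    intro d T
    rw [growthSum, hs, hγ, harmonic_eq_sum_Icc]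
    simp [Real.rpow_neg_one]
  refine fun d hd => ⟨?_, ?_⟩
  · have hl : 0 < Real.log (1 + d) := Real.log_pos (by linarith)
    refine ⟨1 / p + (1 + |Real.log d| / p) / Real.log (1 + d), by positivity, fun T hT => ?_⟩
    rw [hG]
    have hl2 : 0 ≤ Real.log (1 + T) := Real.log_nonneg (by linarith)
    rcases lt_or_ge T d with hTd | hTd
    · have : ⌊(T / d) ^ (1 / p)⌋₊ = 0 := by
        rw [Nat.floor_eq_zero]
        exact Real.rpow_lt_one (by positivity) ((div_lt_one hd).2 hTd) (by positivity)
      rw [this]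
      simp only [harmonic_zero, Rat.cast_zero, mul_zero]
      positivity
    · have h1 := harmonic_floor_le_one_add_log ((T / d) ^ (1 / p))
        (Real.one_le_rpow ((one_le_div hd).2 hTd) (by positivity))
      rw [Real.log_rpow (by positivity), Real.log_div hT.ne' hd.ne'] at h1
      have h2 : Real.log T ≤ Real.log (1 + T) := Real.log_le_log hT (by linarith)
      have h3 : Real.log (1 + d) ≤ Real.log (1 + T) := Real.log_le_log (by linarith) (by linarith)
      have h4 : (1 + |Real.log d| / p)
          ≤ (1 + |Real.log d| / p) / Real.log (1 + d) * Real.log (1 + T) := by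
        rw [div_mul_eq_mul_div, le_div_iff₀ hl]
        gcongr
      have h5 : (harmonic ⌊(T / d) ^ (1 / p)⌋₊ : ℝ)
          ≤ (1 / p + (1 + |Real.log d| / p) / Real.log (1 + d)) * Real.log (1 + T) := by
        have h6 : 1 / p * (Real.log T - Real.log d)
            ≤ 1 / p * Real.log (1 + T) + |Real.log d| / p := by
          rw [div_eq_mul_one_div (|Real.log d|), mul_comm (|Real.log d|), ← mul_add]
          gcongr
          linarith [neg_abs_le (Real.log d)]
        rw [add_mul]
        linarith
      calc _ ≤ T ^ (r / p) * ((1 / p + (1 + |Real.log d| / p) / Real.log (1 + d))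
              * Real.log (1 + T)) := by gcongr
        _ = (1 / p + (1 + |Real.log d| / p) / Real.log (1 + d))
              * (T ^ (r / p) * Real.log (1 + T)) := by ring
        _ ≤ _ := by gcongr; linarith
  -- The threshold `2 d²` is what turns `log (1 + T) ≤ log 2 + log T` into `log (1 + T) ≤ 2 (log T -
  -- log d)`, and the harmonic sum is at least `(log T - log d)/p`.
  · refine exists_le_growthSum (C := 2 * p) (T₀ := max 1 (2 * d ^ 2))
      (fun x hx y hy hxy => ?_) (fun x hx => ?_) (by positivity) (by positivity)
      (fun T hT hdT => ?_)
    · have hx' : 0 ≤ x := hx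
      have h1 : Real.log (1 + x) ≤ Real.log (1 + y) := Real.log_le_log (by linarith) (by linarith)
      have h2 : 0 ≤ Real.log (1 + x) := Real.log_nonneg (by linarith)
      exact mul_le_mul (Real.rpow_le_rpow hx' hxy hrp.le) h1 h2 (Real.rpow_nonneg hy _)
    · exact mul_nonneg (Real.rpow_nonneg hx _) (Real.log_nonneg (by linarith))
    · rw [hG]
      have hT1 : 1 ≤ T := (le_max_left _ _).trans hdT
      have hT2 : 2 * d ^ 2 ≤ T := (le_max_right _ _).trans hdT
      have h1 := log_le_harmonic_floor ((T / d) ^ (1 / p)) (by positivity)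
      rw [Real.log_rpow (by positivity), Real.log_div hT.ne' hd.ne'] at h1
      have h2 : Real.log (1 + T) ≤ Real.log 2 + Real.log T := by
        rw [← Real.log_mul two_ne_zero hT.ne']
        exact Real.log_le_log (by linarith) (by linarith)
      have h3 : Real.log 2 + 2 * Real.log d ≤ Real.log T := by
        have : Real.log (2 * d ^ 2) = Real.log 2 + 2 * Real.log d := by
          rw [Real.log_mul two_ne_zero (by positivity), Real.log_pow]; norm_num
        rw [← this]
        exact Real.log_le_log (by positivity) hT2
      have h4 : Real.log (1 + T) ≤ 2 * p * (harmonic ⌊(T / d) ^ (1 / p)⌋₊ : ℝ) := by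
        have h5 : 2 * p * (1 / p * (Real.log T - Real.log d)) = 2 * (Real.log T - Real.log d) := by
          field_simp
        have h6 := mul_le_mul_of_nonneg_left h1 (by positivity : (0 : ℝ) ≤ 2 * p)
        linarith
      calc _ ≤ T ^ (r / p) * (2 * p * (harmonic ⌊(T / d) ^ (1 / p)⌋₊ : ℝ)) := by gcongr
        _ = _ := by ring

end Growth

/-! ### Comparing the series with an integral, by counting atoms. -/

/-- Layer-cake comparison of the integrals of an antitone function against two measures. -/
theorem lintegral_le_of_measure_Iic_le {μ ν : Measure ℝ} {C : ℝ≥0∞}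
    (hμν : ∀ y, μ (Set.Iic y) ≤ C * (ν (Set.Iio y) + 1)) {h : ℝ → ℝ≥0∞} (hh : Antitone h)
    (h1 : ∀ x, h x ≤ 1) :
    ∫⁻ x, h x ∂μ ≤ C * (∫⁻ x, h x ∂ν + 1) := by
  -- Superlevel sets of an antitone function are lower sets. A nonempty bounded one lies between the
  -- open and the closed half-line at its supremum, so the closed half-line on the left of `hμν` and
  -- the open one on the right cover both kinds; the whole line is a limit.
  have hset : ∀ L : Set ℝ, IsLowerSet L → μ L ≤ C * (ν L + 1) := by
    intro L hL
    rcases L.eq_empty_or_nonempty with rfl | hne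
    · simp
    by_cases hb : BddAbove L
    · have hsub : L ⊆ Set.Iic (sSup L) := fun x hx => le_csSup hb hx
      have hsup : Set.Iio (sSup L) ⊆ L := fun x hx => by
        obtain ⟨y, hy, hxy⟩ := exists_lt_of_lt_csSup hne hx
        exact hL hxy.le hy
      refine (measure_mono hsub).trans ((hμν _).trans ?_)
      gcongr
    · have hun : L = Set.univ := Set.eq_univ_of_forall fun x => by
        obtain ⟨y, hy, hxy⟩ := not_bddAbove_iff.1 hb x
        exact hL hxy.le hy
      subst hun
      have hU : (⋃ n : ℕ, Set.Iic (n : ℝ)) = Set.univ := Set.eq_univ_of_forall fun x => by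
        obtain ⟨n, hn⟩ := exists_nat_ge x
        exact Set.mem_iUnion.2 ⟨n, hn⟩
      have hmono : Monotone fun n : ℕ => Set.Iic (n : ℝ) := fun a b hab =>
        Set.Iic_subset_Iic.2 (by exact_mod_cast hab)
      rw [← hU, hmono.measure_iUnion, hU]
      refine iSup_le fun n => (hμν _).trans ?_
      gcongr
      exact Set.subset_univ _
  have hfin : ∀ x, h x ≠ ⊤ := fun x => ne_top_of_le_ne_top ENNReal.one_ne_top (h1 x)
  set f : ℝ → ℝ := fun x => (h x).toReal with hf
  have hfa : Antitone f := fun x y hxy => ENNReal.toReal_mono (hfin x) (hh hxy)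
  have hfm : Measurable f := hfa.measurable
  have hof : ∀ x, h x = ENNReal.ofReal (f x) := fun x => (ENNReal.ofReal_toReal (hfin x)).symm
  have hcake : ∀ κ : Measure ℝ, ∫⁻ x, h x ∂κ = ∫⁻ t in Set.Ioi (0 : ℝ), κ {x | t < f x} := by
    intro κ
    simp_rw [hof]
    exact lintegral_eq_lintegral_meas_lt κ (ae_of_all _ fun x => ENNReal.toReal_nonneg)
      hfm.aemeasurable
  rw [hcake, hcake]
  have hlow : ∀ t, IsLowerSet {x | t < f x} := fun t x y hxy hx => lt_of_lt_of_le hx (hfa hxy)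
  -- As `h ≤ 1`, levels `t ≥ 1` are never exceeded; the additive constant is integrated only over
  -- `(0, 1)`.
  have hpt : ∀ t, μ {x | t < f x}
      ≤ C * (ν {x | t < f x} + (Set.Iio (1 : ℝ)).indicator (fun _ => 1) t) := by
    intro t
    by_cases ht : t < 1
    · rw [Set.indicator_of_mem (by exact ht)]
      exact hset _ (hlow t)
    · have : {x | t < f x} = ∅ := Set.eq_empty_of_forall_notMem fun x hx => by
        have h2 : f x ≤ 1 := by simpa using ENNReal.toReal_mono ENNReal.one_ne_top (h1 x)
        exact ht (lt_of_lt_of_le hx h2)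
      simp [this]
  have hmeas : Measurable fun t => ν {x | t < f x} :=
    Antitone.measurable fun s t hst => measure_mono fun x (hx : t < f x) => lt_of_le_of_lt hst hx
  have hind : Measurable ((Set.Iio (1 : ℝ)).indicator fun _ => (1 : ℝ≥0∞)) :=
    measurable_const.indicator measurableSet_Iio
  calc ∫⁻ t in Set.Ioi (0 : ℝ), μ {x | t < f x}
      ≤ ∫⁻ t in Set.Ioi (0 : ℝ),
          C * (ν {x | t < f x} + (Set.Iio (1 : ℝ)).indicator (fun _ => 1) t) :=
        lintegral_mono hpt
    _ = C * ((∫⁻ t in Set.Ioi (0 : ℝ), ν {x | t < f x}) + 1) := by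
        rw [lintegral_const_mul (f := fun t => ν {x | t < f x} + (Set.Iio (1 : ℝ)).indicator (fun _ => 1) t)
          C (hmeas.add hind), lintegral_add_left hmeas,
          lintegral_indicator measurableSet_Iio, setLIntegral_const,
          Measure.restrict_apply measurableSet_Iio, Set.inter_comm, Set.Ioi_inter_Iio]
        simp

/-- The weight of the atom `(n, i)`. -/
noncomputable def atomWeight (r : ℝ) (n i : ℕ) : ℝ≥0∞ :=
  if 1 ≤ i ∧ i ≤ n then ENNReal.ofReal ((n : ℝ) ^ (r - 2)) else 0

/-- The total weight of the atoms with `n ^ (p + β) * i ^ (-β) ≤ U`. -/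
noncomputable def atomCount (r p β U : ℝ) : ℝ≥0∞ :=
  ∑' i : ℕ, ∑' n : ℕ, if (n : ℝ) ^ (p + β) * (i : ℝ) ^ (-β) ≤ U then atomWeight r n i else 0

section Counting

variable {r p β : ℝ}

theorem rpow_mul_rpow_neg_le_iff (hβ : 0 < β + p) {n i : ℕ} (hi : 1 ≤ i) {U : ℝ} (hU : 0 < U) :
    (n : ℝ) ^ (p + β) * (i : ℝ) ^ (-β) ≤ U ↔ (n : ℝ) ≤ (U * (i : ℝ) ^ β) ^ (1 / (p + β)) := by
  have hi0 : (0 : ℝ) < i := by exact_mod_cast hi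
  have hpb : 0 < p + β := by linarith
  rw [Real.rpow_neg hi0.le, ← div_eq_mul_inv, div_le_iff₀ (by positivity), one_div,
    Real.le_rpow_inv_iff_of_pos (by positivity) (by positivity) hpb]

theorem rpow_one_div_rpow_sub_one {i : ℕ} (hi : 1 ≤ i) {U : ℝ} (hU : 0 < U) :
    ((U * (i : ℝ) ^ β) ^ (1 / (p + β))) ^ (r - 2 + 1)
      = U ^ ((r - 1) / (p + β)) * (i : ℝ) ^ (β * ((r - 1) / (p + β))) := by
  have hi0 : (0 : ℝ) < i := by exact_mod_cast hi
  rw [← Real.rpow_mul (by positivity), Real.mul_rpow hU.le (by positivity),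
    ← Real.rpow_mul hi0.le]
  congr 2 <;> ring

/-- For `n ≥ i` one has `n^(p+β) i^(-β) ≥ i^p`, so only `i ≤ U^(1/p)` contribute. For such `i` the
constraint `n ≥ i` is dropped, and the power sum of exponent `r - 2 > -1` is bounded. -/
theorem exists_atomCount_le (hr : 1 < r) (hp : 0 < p) (hβ : 0 < β + p) :
    ∃ C : ℝ, 0 ≤ C ∧ ∀ U, 0 < U →
      atomCount r p β U ≤ ENNReal.ofReal (C * growthSum r p β 1 U) := by
  obtain ⟨C, hC, hCle⟩ := exists_sum_Icc_rpow_le (α := r - 2) (by linarith)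
  refine ⟨C, hC.le, fun U hU => ?_⟩
  have hinner : ∀ i : ℕ, (∑' n : ℕ, if (n : ℝ) ^ (p + β) * (i : ℝ) ^ (-β) ≤ U
      then atomWeight r n i else 0) ≤ if i ∈ Finset.Icc 1 ⌊(U / 1) ^ (1 / p)⌋₊
        then ENNReal.ofReal (C * (U ^ ((r - 1) / (p + β))
          * (i : ℝ) ^ (β * ((r - 1) / (p + β))))) else 0 := by
    intro i
    have hzero : ∀ n : ℕ, n ∉ Finset.Icc 1 ⌊(U * (i : ℝ) ^ β) ^ (1 / (p + β))⌋₊ →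
        (if (n : ℝ) ^ (p + β) * (i : ℝ) ^ (-β) ≤ U then atomWeight r n i else 0) = 0 := by
      intro n hn
      by_cases h : 1 ≤ i ∧ i ≤ n
      · refine if_neg fun h2 => hn (Finset.mem_Icc.2 ⟨h.1.trans h.2, Nat.le_floor ?_⟩)
        exact (rpow_mul_rpow_neg_le_iff hβ h.1 hU).1 h2
      · simp [atomWeight, h]
    split_ifs with hi
    · rw [tsum_eq_sum hzero]
      have hi1 := (Finset.mem_Icc.1 hi).1
      calc _ ≤ ∑ n ∈ Finset.Icc 1 ⌊(U * (i : ℝ) ^ β) ^ (1 / (p + β))⌋₊,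
              ENNReal.ofReal ((n : ℝ) ^ (r - 2)) := by
            refine Finset.sum_le_sum fun n _ => ?_
            unfold atomWeight
            split_ifs <;> simp
        _ = ENNReal.ofReal (∑ n ∈ Finset.Icc 1 ⌊(U * (i : ℝ) ^ β) ^ (1 / (p + β))⌋₊,
              (n : ℝ) ^ (r - 2)) :=
            (ENNReal.ofReal_sum_of_nonneg fun _ _ => by positivity).symm
        _ ≤ _ := by
            rw [← rpow_one_div_rpow_sub_one hi1 hU]
            exact ENNReal.ofReal_le_ofReal (hCle _ (by positivity))
    · refine le_of_eq (ENNReal.tsum_eq_zero.2 fun n => ?_)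
      by_cases h : 1 ≤ i ∧ i ≤ n
      · refine if_neg fun h2 => hi (Finset.mem_Icc.2 ⟨h.1, Nat.le_floor ?_⟩)
        have hi0 : (0 : ℝ) < i := by exact_mod_cast h.1
        have hin : (i : ℝ) ≤ n := by exact_mod_cast h.2
        rw [one_div, Real.le_rpow_inv_iff_of_pos (by positivity) (by positivity) hp, div_one]
        calc (i : ℝ) ^ p = (i : ℝ) ^ (p + β) * (i : ℝ) ^ (-β) := by
              rw [← Real.rpow_add hi0]; ring_nf
          _ ≤ (n : ℝ) ^ (p + β) * (i : ℝ) ^ (-β) := by gcongr; linarith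
          _ ≤ U := h2
      · simp [atomWeight, h]
  refine (ENNReal.tsum_le_tsum hinner).trans (le_of_eq ?_)
  rw [tsum_eq_sum (s := Finset.Icc 1 ⌊(U / 1) ^ (1 / p)⌋₊) (fun i hi => if_neg hi),
    Finset.sum_congr rfl fun i hi => if_pos hi,
    ← ENNReal.ofReal_sum_of_nonneg fun _ _ => by positivity, growthSum, Finset.mul_sum,
    Finset.mul_sum]

/-- The smaller cut-off for `i`, with `U` divided by `2^(p+β)`, ensures that `2 i` is at most the
largest admissible real value for `n`, so that a fixed proportion of the power sum lies in `n ≥ i`.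
-/
theorem exists_growthSum_le_atomCount (hp : 0 < p) (hβ : 0 < β + p) :
    ∃ C : ℝ, 0 ≤ C ∧ ∀ U, 0 < U →
      ENNReal.ofReal (growthSum r p β (2 ^ (p + β)) U) ≤ ENNReal.ofReal C * atomCount r p β U := by
  have hpb : 0 < p + β := by linarith
  obtain ⟨c, hc, hcle⟩ := exists_le_sum_Icc_rpow (r - 2)
  refine ⟨c⁻¹, by positivity, fun U hU => ?_⟩
  have hinner : ∀ i ∈ Finset.Icc 1 ⌊(U / 2 ^ (p + β)) ^ (1 / p)⌋₊,
      ENNReal.ofReal (c * (U ^ ((r - 1) / (p + β)) * (i : ℝ) ^ (β * ((r - 1) / (p + β)))))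
      ≤ ∑' n : ℕ, if (n : ℝ) ^ (p + β) * (i : ℝ) ^ (-β) ≤ U then atomWeight r n i else 0 := by
    intro i hi
    obtain ⟨hi1, hi2⟩ := Finset.mem_Icc.1 hi
    have hi0 : (0 : ℝ) < i := by exact_mod_cast hi1
    have hiU : (i : ℝ) ≤ (U / 2 ^ (p + β)) ^ (1 / p) := (Nat.le_floor_iff (by positivity)).1 hi2
    rw [one_div, Real.le_rpow_inv_iff_of_pos (by positivity) (by positivity) hp,
      le_div_iff₀ (by positivity)] at hiU
    have h2i : 2 * (i : ℝ) ≤ (U * (i : ℝ) ^ β) ^ (1 / (p + β)) := by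
      rw [one_div, Real.le_rpow_inv_iff_of_pos (by positivity) (by positivity) hpb,
        Real.mul_rpow two_pos.le hi0.le, Real.rpow_add hi0]
      calc _ = (i : ℝ) ^ p * 2 ^ (p + β) * (i : ℝ) ^ β := by ring
        _ ≤ _ := by gcongr
    rw [← rpow_one_div_rpow_sub_one hi1 hU]
    calc _ ≤ ENNReal.ofReal (∑ n ∈ Finset.Icc i ⌊(U * (i : ℝ) ^ β) ^ (1 / (p + β))⌋₊,
              (n : ℝ) ^ (r - 2)) := ENNReal.ofReal_le_ofReal (hcle _ _ hi1 h2i)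
      _ = ∑ n ∈ Finset.Icc i ⌊(U * (i : ℝ) ^ β) ^ (1 / (p + β))⌋₊,
              ENNReal.ofReal ((n : ℝ) ^ (r - 2)) :=
            ENNReal.ofReal_sum_of_nonneg fun _ _ => by positivity
      _ ≤ ∑ n ∈ Finset.Icc i ⌊(U * (i : ℝ) ^ β) ^ (1 / (p + β))⌋₊,
            if (n : ℝ) ^ (p + β) * (i : ℝ) ^ (-β) ≤ U then atomWeight r n i else 0 := by
          refine Finset.sum_le_sum fun n hn => ?_
          obtain ⟨hn1, hn2⟩ := Finset.mem_Icc.1 hn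
          have h1 := (rpow_mul_rpow_neg_le_iff (p := p) (n := n) hβ hi1 hU).2
            ((Nat.le_floor_iff (by positivity)).1 hn2)
          rw [if_pos h1, atomWeight, if_pos ⟨hi1, hn1⟩]
      _ ≤ _ := ENNReal.sum_le_tsum _
  calc ENNReal.ofReal (growthSum r p β (2 ^ (p + β)) U)
      = ENNReal.ofReal c⁻¹ * ∑ i ∈ Finset.Icc 1 ⌊(U / 2 ^ (p + β)) ^ (1 / p)⌋₊, ENNReal.ofReal
          (c * (U ^ ((r - 1) / (p + β)) * (i : ℝ) ^ (β * ((r - 1) / (p + β))))) := by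
        rw [← ENNReal.ofReal_sum_of_nonneg fun _ _ => by positivity,
          ← ENNReal.ofReal_mul (by positivity), ← Finset.mul_sum, ← mul_assoc,
          inv_mul_cancel₀ hc.ne', one_mul, growthSum, Finset.mul_sum]
    _ ≤ _ := by
        gcongr
        exact (Finset.sum_le_sum hinner).trans (ENNReal.sum_le_tsum _)

/-- Rescaling the argument only changes the cut-off parameter `d` and a constant. This is why
`GrowthComparable` is required for every `d`, and why `c` is immaterial in `tailSeries`. -/
theorem growthSum_div {d c T : ℝ} (hc : 0 < c) (hT : 0 < T) :
    growthSum r p β d (T / c) = (c ^ ((r - 1) / (p + β)))⁻¹ * growthSum r p β (c * d) T := by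
  rw [growthSum, growthSum, Real.div_rpow hT.le hc.le, div_div]
  ring

end Counting

/-- The weighted series `∑ₙ n ^ (r - 2) ∑_{i ≤ n} g (c n ^ (p + β) i ^ (-β))`. -/
noncomputable def tailSeries (r p β c : ℝ) (g : ℝ → ℝ≥0∞) : ℝ≥0∞ :=
  ∑' n : ℕ, ∑' i : ℕ, atomWeight r n i * g (c * ((n : ℝ) ^ (p + β) * (i : ℝ) ^ (-β)))

/-- Strictly increasing bijections of `[0, ∞)`. -/
structure IsIncreasingBijection (f : ℝ → ℝ) : Prop where
  strictMonoOn : StrictMonoOn f (Set.Ici 0)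
  map_zero : f 0 = 0
  surj : ∀ y, 0 ≤ y → ∃ T, 0 ≤ T ∧ f T = y

/-- Place each atom at the image under `f` of its threshold. The series is then the integral of `h`
against this discrete measure, and the counting estimates compare its half-lines with Lebesgue
measure in both directions. -/
theorem tailSeries_lt_top_iff {r p β : ℝ} (hr : 1 < r) (hp : 0 < p) (hβ : 0 < β + p) {f : ℝ → ℝ}
    (hf : IsIncreasingBijection f) (hG : GrowthComparable r p β f) {c : ℝ} (hc : 0 < c)
    {g h : ℝ → ℝ≥0∞} (hh : Antitone h) (h1 : ∀ x, h x ≤ 1) (hgh : ∀ t, 0 ≤ t → h (f t) = g t) :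
    tailSeries r p β c g < ⊤ ↔ ∫⁻ x in Set.Ioi (0 : ℝ), h x < ⊤ := by
  have hpb : 0 < p + β := by linarith
  let τ : ℕ × ℕ → ℝ := fun k => c * ((k.2 : ℝ) ^ (p + β) * (k.1 : ℝ) ^ (-β))
  have hτ0 : ∀ k, 0 ≤ τ k := fun k => by positivity
  let μ : Measure ℝ := Measure.sum fun k : ℕ × ℕ =>
    atomWeight r k.2 k.1 • Measure.dirac (f (τ k))
  have hμint : ∫⁻ x, h x ∂μ = tailSeries r p β c g := by
    rw [lintegral_sum_measure, tailSeries, ENNReal.tsum_comm, ENNReal.tsum_prod']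
    refine tsum_congr fun i => tsum_congr fun n => ?_
    rw [lintegral_smul_measure, lintegral_dirac' _ hh.measurable, smul_eq_mul,
      hgh _ (hτ0 _)]
  have hμs : ∀ s : Set ℝ, MeasurableSet s → μ s = ∑' i : ℕ, ∑' n : ℕ,
      s.indicator (fun _ => atomWeight r n i) (f (τ (i, n))) := by
    intro s hs
    rw [Measure.sum_apply _ hs, ENNReal.tsum_prod']
    refine tsum_congr fun i => tsum_congr fun n => ?_
    rw [Measure.smul_apply, Measure.dirac_apply' _ hs, smul_eq_mul]
    by_cases hmem : f (τ (i, n)) ∈ s <;> simp [hmem]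
  have hcount : ∀ T, atomCount r p β (T / c) = ∑' i : ℕ, ∑' n : ℕ,
      if τ (i, n) ≤ T then atomWeight r n i else 0 := by
    intro T
    refine tsum_congr fun i => tsum_congr fun n => if_congr ?_ rfl rfl
    rw [le_div_iff₀ hc, mul_comm]
  have hν : ∀ y : ℝ, 0 < y → (volume.restrict (Set.Ioi (0 : ℝ))) (Set.Iio y) = ENNReal.ofReal y ∧
      (volume.restrict (Set.Ioi (0 : ℝ))) (Set.Iic y) = ENNReal.ofReal y := by
    intro y hy
    rw [Measure.restrict_apply measurableSet_Iio, Measure.restrict_apply measurableSet_Iic,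
      Set.inter_comm, Set.Ioi_inter_Iio, Set.inter_comm, Set.Ioi_inter_Iic]
    simp
  have hfpos : ∀ y, 0 < y → ∃ T, 0 < T ∧ f T = y := by
    intro y hy
    obtain ⟨T, hT, hTy⟩ := hf.surj y hy.le
    refine ⟨T, hT.lt_of_ne ?_, hTy⟩
    rintro rfl
    rw [hf.map_zero] at hTy
    exact hy.ne hTy
  obtain ⟨C₁, hC₁, hup⟩ := exists_atomCount_le hr hp hβ
  obtain ⟨C₂, hC₂, hlo⟩ := exists_growthSum_le_atomCount (r := r) hp hβ
  constructor
  · intro hJ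
    -- Counting up to `T / (2c)` instead of `T / c` puts the counted atoms strictly below `f T`, as
    -- an open half-line requires.
    obtain ⟨C₃, hC₃, h3⟩ := (hG (2 * c * 2 ^ (p + β)) (by positivity)).2
    set B := ENNReal.ofReal (C₃ * (2 * c) ^ ((r - 1) / (p + β)) * C₂ + C₃)
    refine lt_of_le_of_lt (lintegral_le_of_measure_Iic_le (C := B) (ν := μ) (fun y => ?_) hh h1) ?_
    · rcases le_or_gt y 0 with hy | hy
      · rw [Measure.restrict_apply measurableSet_Iic, Set.inter_comm, Set.Ioi_inter_Iic,
          Set.Ioc_eq_empty (not_lt.2 hy)]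
        simp
      obtain ⟨T, hT, rfl⟩ := hfpos y hy
      rw [(hν _ hy).2]
      have hcnt : atomCount r p β (T / (2 * c)) ≤ μ (Set.Iio (f T)) := by
        rw [← div_div, hcount, hμs _ measurableSet_Iio]
        refine ENNReal.tsum_le_tsum fun i => ENNReal.tsum_le_tsum fun n => ?_
        split_ifs with hle
        · rw [Set.indicator_of_mem]
          exact hf.strictMonoOn (hτ0 _) hT.le (lt_of_le_of_lt hle (by linarith))
        · exact zero_le
      have h4 := h3 T hT
      have h5 := growthSum_div (r := r) (p := p) (β := β) (d := 2 ^ (p + β))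
        (c := 2 * c) (by positivity) hT
      have h6 : growthSum r p β (2 * c * 2 ^ (p + β)) T
          = (2 * c) ^ ((r - 1) / (p + β)) * growthSum r p β (2 ^ (p + β)) (T / (2 * c)) := by
        rw [h5, mul_inv_cancel_left₀ (by positivity)]
      rw [h6] at h4
      have hlo' := (hlo (T / (2 * c)) (by positivity)).trans (mul_le_mul_right hcnt _)
      have hg0 := growthSum_nonneg (r := r) (p := p) (β := β) (d := 2 ^ (p + β))
        (T := T / (2 * c)) (by positivity)
      set G := growthSum r p β (2 ^ (p + β)) (T / (2 * c))
      set P := (2 * c) ^ ((r - 1) / (p + β))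
      have hP : 0 ≤ P := by positivity
      calc ENNReal.ofReal (f T) ≤ ENNReal.ofReal (C₃ * P * G + C₃) :=
            ENNReal.ofReal_le_ofReal (by linarith)
        _ = ENNReal.ofReal (C₃ * P) * ENNReal.ofReal G + ENNReal.ofReal C₃ := by
            rw [ENNReal.ofReal_add (by positivity) hC₃, ENNReal.ofReal_mul (by positivity)]
        _ ≤ ENNReal.ofReal (C₃ * P) * (ENNReal.ofReal C₂ * μ (Set.Iio (f T)))
              + ENNReal.ofReal C₃ := by gcongr
        _ ≤ B * μ (Set.Iio (f T)) + B := by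
            rw [← mul_assoc, ← ENNReal.ofReal_mul (by positivity)]
            gcongr <;> apply ENNReal.ofReal_le_ofReal
            · linarith
            · have : 0 ≤ C₃ * P * C₂ := by positivity
              linarith
        _ = _ := by rw [mul_add, mul_one]
    · rw [hμint]
      exact ENNReal.mul_lt_top ENNReal.ofReal_lt_top (ENNReal.add_lt_top.2 ⟨hJ, ENNReal.one_lt_top⟩)
  · intro hI
    obtain ⟨C₃, hC₃, h3⟩ := (hG (c * 1) (by positivity)).1
    set P := (c ^ ((r - 1) / (p + β)))⁻¹ with hPdef
    have hP : 0 ≤ P := by positivity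
    rw [← hμint]
    refine lt_of_le_of_lt (lintegral_le_of_measure_Iic_le (C := ENNReal.ofReal (C₁ * (P * C₃)))
      (ν := volume.restrict (Set.Ioi 0)) (fun y => ?_) hh h1) ?_
    · rcases le_or_gt y 0 with hy | hy
      -- Atoms of positive weight have `1 ≤ i ≤ n`, hence sit at positive points; the atoms at `n =
      -- 0` or `i = 0` carry no weight.
      · refine le_of_eq_of_le (b := (0 : ℝ≥0∞)) ?_ zero_le
        rw [hμs _ measurableSet_Iic]
        refine ENNReal.tsum_eq_zero.2 fun i => ENNReal.tsum_eq_zero.2 fun n => ?_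
        by_cases hin : 1 ≤ i ∧ i ≤ n
        · have hi0 : (0 : ℝ) < i := by exact_mod_cast hin.1
          have hn0 : (0 : ℝ) < n := by exact_mod_cast hin.1.trans hin.2
          have hpos : 0 < τ (i, n) := by
            show 0 < c * ((n : ℝ) ^ (p + β) * (i : ℝ) ^ (-β))
            positivity
          have hfp := hf.strictMonoOn (Set.mem_Ici.2 le_rfl) hpos.le hpos
          rw [hf.map_zero] at hfp
          have hnot : f (τ (i, n)) ∉ Set.Iic y := fun hmem =>
            absurd (le_trans (Set.mem_Iic.1 hmem) hy) (not_le.2 hfp)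
          simp [hnot]
        · simp [atomWeight, hin]
      obtain ⟨T, hT, rfl⟩ := hfpos y hy
      rw [(hν _ hy).1]
      have hcnt : μ (Set.Iic (f T)) ≤ atomCount r p β (T / c) := by
        rw [hcount, hμs _ measurableSet_Iic]
        refine ENNReal.tsum_le_tsum fun i => ENNReal.tsum_le_tsum fun n => ?_
        by_cases hle : f (τ (i, n)) ≤ f T
        · rw [if_pos ((hf.strictMonoOn.le_iff_le (hτ0 _) hT.le).1 hle)]
          exact Set.indicator_le_self' (fun _ _ => zero_le) _
        · rw [Set.indicator_of_notMem (by exact hle)]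
          exact zero_le
      refine hcnt.trans ((hup _ (by positivity)).trans ?_)
      rw [← ENNReal.ofReal_one, ← ENNReal.ofReal_add hy.le zero_le_one,
        ← ENNReal.ofReal_mul (by positivity), growthSum_div hc hT]
      apply ENNReal.ofReal_le_ofReal
      calc C₁ * (P * growthSum r p β (c * 1) T) ≤ C₁ * (P * (C₃ * (f T + 1))) := by
            gcongr
            exact h3 T hT
        _ = _ := by ring
    · exact ENNReal.mul_lt_top ENNReal.ofReal_lt_top (ENNReal.add_lt_top.2 ⟨hI, ENNReal.one_lt_top⟩)

theorem isIncreasingBijection_rpow {s : ℝ} (hs : 0 < s) : IsIncreasingBijection fun x => x ^ s where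
  strictMonoOn x hx y _ hxy := Real.rpow_lt_rpow hx hxy hs
  map_zero := Real.zero_rpow hs.ne'
  surj y hy := ⟨y ^ s⁻¹, by positivity, Real.rpow_inv_rpow hy hs.ne'⟩

theorem isIncreasingBijection_rpow_mul_log {s : ℝ} (hs : 0 < s) :
    IsIncreasingBijection fun x => x ^ s * Real.log (1 + x) where
  strictMonoOn x hx y _ hxy := by
    have hx' : 0 ≤ x := hx
    have h1 : Real.log (1 + x) < Real.log (1 + y) := Real.log_lt_log (by linarith) (by linarith)
    have h2 : 0 ≤ Real.log (1 + x) := Real.log_nonneg (by linarith)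
    exact mul_lt_mul'' (Real.rpow_lt_rpow hx' hxy hs) h1 (by positivity) h2
  map_zero := by simp
  surj y hy := by
    -- Chosen so that `b^s ≥ y / log 2` and `log (1 + b) ≥ log 2`; the function then passes `y`
    -- before `b`.
    set b := max 2 (y / Real.log 2 + 1) ^ s⁻¹ + 1 with hb
    have hl2 : 0 < Real.log 2 := Real.log_pos one_lt_two
    have hb1 : 1 ≤ b := by
      have : 0 ≤ max 2 (y / Real.log 2 + 1) ^ s⁻¹ := by positivity
      linarith
    have hcont : ContinuousOn (fun x : ℝ => x ^ s * Real.log (1 + x)) (Set.Icc 0 b) := by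
      refine ContinuousOn.mul (Real.continuous_rpow_const hs.le).continuousOn ?_
      exact ContinuousOn.log (by fun_prop) fun x hx => by linarith [hx.1]
    have hyb : y ≤ b ^ s * Real.log (1 + b) := by
      have h1 : y / Real.log 2 ≤ b ^ s := by
        calc y / Real.log 2 ≤ max 2 (y / Real.log 2 + 1) :=
              le_max_of_le_right (by linarith)
          _ = (max 2 (y / Real.log 2 + 1) ^ s⁻¹) ^ s :=
              (Real.rpow_inv_rpow (by positivity) hs.ne').symm
          _ ≤ b ^ s := by gcongr; linarith
      have h2 : Real.log 2 ≤ Real.log (1 + b) := Real.log_le_log two_pos (by linarith)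
      calc y = y / Real.log 2 * Real.log 2 := by field_simp
        _ ≤ _ := by gcongr
    obtain ⟨T, hT, hTy⟩ := intermediate_value_Icc (by linarith) hcont
      ⟨by simpa using hy, hyb⟩
    exact ⟨T, hT.1, hTy⟩

/-! ### Choquet expectations of gauges. -/

namespace SublinearExpectationSpace

variable {Ω : Type*} [MeasurableSpace Ω] {S : SublinearExpectationSpace Ω}

theorem choquet_lt_top_iff {Y : Ω → ℝ} (hY : ∀ ω, 0 ≤ Y ω) :
    S.choquet Y < ⊤ ↔ ∫⁻ x in Set.Ioi (0 : ℝ), S.capacity {ω | x < Y ω} < ⊤ := by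
  have h0 : ∫⁻ x in Set.Iio (0 : ℝ), (1 - S.capacity {ω | x < Y ω}) = 0 := by
    rw [setLIntegral_congr_fun (g := fun _ => 0) measurableSet_Iio]
    · simp
    · intro x hx
      have : {ω | x < Y ω} = Set.univ := Set.eq_univ_of_forall fun ω => lt_of_lt_of_le hx (hY ω)
      simp only [this, capacity_univ, tsub_self]
  rw [choquet, h0, EReal.coe_ennreal_zero, sub_zero, lt_top_iff_ne_top, lt_top_iff_ne_top]
  simp

/-- The Choquet expectation of `f |X|` is finite if and only if the series of tail capacities
converges. -/
theorem choquet_comp_abs_lt_top_iff {r p β : ℝ} (hr : 1 < r) (hp : 0 < p) (hβ : 0 < β + p)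
    {f : ℝ → ℝ} (hf : IsIncreasingBijection f) (hG : GrowthComparable r p β f) {c : ℝ} (hc : 0 < c)
    (X : Ω → ℝ) :
    S.choquet (fun ω => f |X ω|) < ⊤ ↔
      tailSeries r p β c (fun t => S.capacity {ω | t < |X ω|}) < ⊤ := by
  have hf0 : ∀ x, 0 ≤ x → 0 ≤ f x := fun x hx => by
    simpa [hf.map_zero] using hf.strictMonoOn.monotoneOn (Set.mem_Ici.2 le_rfl) hx hx
  rw [choquet_lt_top_iff fun ω => hf0 _ (abs_nonneg _)]
  refine (tailSeries_lt_top_iff hr hp hβ hf hG hc ?_ (fun _ => capacity_le_one _) ?_).symm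
  · exact fun x y hxy => capacity_mono fun ω (hω : y < _) => lt_of_le_of_lt hxy hω
  · intro t ht
    refine congrArg S.capacity (Set.ext fun ω => ?_)
    exact hf.strictMonoOn.lt_iff_lt ht (Set.mem_Ici.2 (abs_nonneg (X ω)))

/-- Markov's inequality for the Choquet expectation. -/
theorem exists_er_tail_le {X : Ω → ℝ} (hX : X ∈ S.H) {f : ℝ → ℝ} (hf : IsIncreasingBijection f)
    {q : ℝ} (hq : ∀ t, 1 ≤ t → Real.log 2 * t ^ q ≤ f t)
    (hC : S.choquet (fun ω => f |X ω|) < ⊤) :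
    ∃ K : ℝ, ∀ t, 1 ≤ t → S.er ({ω | t < |X ω|}.indicator fun _ => 1) ≤ K * t ^ (-q) := by
  have hf0 : ∀ x, 0 ≤ x → 0 ≤ f x := fun x hx => by
    simpa [hf.map_zero] using hf.strictMonoOn.monotoneOn (Set.mem_Ici.2 le_rfl) hx hx
  rw [choquet_lt_top_iff fun ω => hf0 _ (abs_nonneg _)] at hC
  set I := ∫⁻ x in Set.Ioi (0 : ℝ), S.capacity {ω | x < f |X ω|} with hI
  have hl2 : 0 < Real.log 2 := Real.log_pos one_lt_two
  refine ⟨I.toReal / Real.log 2, fun t ht => ?_⟩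
  have ht0 : 0 < t := by linarith
  have hm : MeasurableSet {ω | t < |X ω|} :=
    measurableSet_lt measurable_const (S.measurable_of_mem X hX).abs
  have hft : 0 ≤ f t := hf0 t ht0.le
  have he0 : 0 ≤ S.er ({ω | t < |X ω|}.indicator fun _ => 1) :=
    er_nonneg (Bounded.indicator hm) (Set.indicator_nonneg fun _ _ => zero_le_one)
  have h1 : S.capacity {ω | t < |X ω|} * ENNReal.ofReal (f t) ≤ I := by
    calc _ = ∫⁻ _ in Set.Ioo (0 : ℝ) (f t), S.capacity {ω | t < |X ω|} := by
          rw [setLIntegral_const]; simp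
      _ ≤ ∫⁻ x in Set.Ioo (0 : ℝ) (f t), S.capacity {ω | x < f |X ω|} := by
          refine setLIntegral_mono' measurableSet_Ioo fun x hx => capacity_mono fun ω hω => ?_
          exact hx.2.trans (hf.strictMonoOn ht0.le (abs_nonneg (X ω)) hω)
      _ ≤ I := lintegral_mono_set Set.Ioo_subset_Ioi_self
  rw [capacity_eq_er hm, ← ENNReal.ofReal_mul he0] at h1
  have h2 := (ENNReal.ofReal_le_iff_le_toReal hC.ne).1 h1
  have h3 : S.er ({ω | t < |X ω|}.indicator fun _ => 1) * (Real.log 2 * t ^ q) ≤ I.toReal :=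
    (mul_le_mul_of_nonneg_left (hq t ht) he0).trans h2
  rw [Real.rpow_neg ht0.le, ← div_eq_mul_inv, div_div, le_div_iff₀ (by positivity)]
  exact h3

end SublinearExpectationSpace

/-! ### Numerical estimates: row sums of weights, the exponential bound, products. -/

section Weights

variable {p β : ℝ}

theorem weight_eq {n i : ℕ} (hn : 1 ≤ n) (hi : 1 ≤ i) :
    ((i : ℝ) / (n : ℝ)) ^ β * (1 / (n : ℝ)) ^ p = ((n : ℝ) ^ (p + β) * (i : ℝ) ^ (-β))⁻¹ := by
  have hn0 : (0 : ℝ) < n := by exact_mod_cast hn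
  have hi0 : (0 : ℝ) < i := by exact_mod_cast hi
  rw [Real.div_rpow hi0.le hn0.le, Real.div_rpow zero_le_one hn0.le, Real.one_rpow,
    Real.rpow_add hn0, Real.rpow_neg hi0.le, mul_inv, inv_inv, mul_inv]
  ring

/-- The row sums of the `q`-th powers of the weights decay polynomially if `p * q > 1`. -/
theorem exists_sum_weight_rpow_le (hβ : 0 < β + p) {q : ℝ} (hq : 0 < q) (hpq : 1 < p * q) :
    ∃ η : ℝ, 0 < η ∧ ∃ C : ℝ, 0 ≤ C ∧ ∀ n : ℕ, 1 ≤ n →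
      ∑ i ∈ Finset.Icc 1 n, (((n : ℝ) ^ (p + β) * (i : ℝ) ^ (-β))⁻¹) ^ q ≤ C * (n : ℝ) ^ (-η) := by
  have hpb : 0 < p + β := by linarith
  -- The terms are bounded by `i⁻¹ n^(-2η)` up to a constant. The halving leaves one factor `n^(-η)`
  -- to absorb the logarithm from the harmonic sum, which makes all signs of `βq + 1` alike.
  set η := min ((p + β) * q) (p * q - 1) / 2 with hη
  have hη0 : 0 < η := half_pos (lt_min (by positivity) (by linarith))
  refine ⟨η, hη0, 2 * (1 + 1 / η), by positivity, fun n hn => ?_⟩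
  have hn1 : (1 : ℝ) ≤ n := by exact_mod_cast hn
  have hn0 : (0 : ℝ) < n := by linarith
  have hterm : ∀ i ∈ Finset.Icc 1 n, (((n : ℝ) ^ (p + β) * (i : ℝ) ^ (-β))⁻¹) ^ q
      ≤ (i : ℝ)⁻¹ * (2 * (n : ℝ) ^ (-(2 * η))) := by
    intro i hi
    obtain ⟨hi1, hin⟩ := Finset.mem_Icc.1 hi
    have hi0 : (0 : ℝ) < i := by exact_mod_cast hi1
    have hi1' : (1 : ℝ) ≤ i := by exact_mod_cast hi1
    have hin' : (i : ℝ) ≤ n := by exact_mod_cast hin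
    have e1 : (((n : ℝ) ^ (p + β) * (i : ℝ) ^ (-β))⁻¹) ^ q
        = (i : ℝ)⁻¹ * ((i : ℝ) ^ (β * q + 1) * (n : ℝ) ^ (-((p + β) * q))) := by
      rw [Real.rpow_add_one hi0.ne', mul_inv, ← Real.rpow_neg hn0.le, ← Real.rpow_neg hi0.le,
        neg_neg, Real.mul_rpow (by positivity) (by positivity), ← Real.rpow_mul hn0.le,
        ← Real.rpow_mul hi0.le, neg_mul]
      field_simp
    rw [e1]
    refine mul_le_mul_of_nonneg_left ?_ (by positivity)
    rcases le_total 0 (β * q + 1) with h | h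
    · have h1 : (i : ℝ) ^ (β * q + 1) ≤ (n : ℝ) ^ (β * q + 1) := by gcongr
      have h2 : (n : ℝ) ^ (β * q + 1) * (n : ℝ) ^ (-((p + β) * q)) = (n : ℝ) ^ (-(p * q - 1)) := by
        rw [← Real.rpow_add hn0]; ring_nf
      have h3 : (n : ℝ) ^ (-(p * q - 1)) ≤ (n : ℝ) ^ (-(2 * η)) := by
        apply Real.rpow_le_rpow_of_exponent_le hn1
        have := min_le_right ((p + β) * q) (p * q - 1)
        rw [hη]; linarith
      calc _ ≤ (n : ℝ) ^ (β * q + 1) * (n : ℝ) ^ (-((p + β) * q)) := by gcongr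
        _ ≤ (n : ℝ) ^ (-(2 * η)) := h2 ▸ h3
        _ ≤ _ := by linarith [Real.rpow_pos_of_pos hn0 (-(2 * η))]
    · have h1 : (i : ℝ) ^ (β * q + 1) ≤ 1 := Real.rpow_le_one_of_one_le_of_nonpos hi1' h
      have h3 : (n : ℝ) ^ (-((p + β) * q)) ≤ (n : ℝ) ^ (-(2 * η)) := by
        apply Real.rpow_le_rpow_of_exponent_le hn1
        have := min_le_left ((p + β) * q) (p * q - 1)
        rw [hη]; linarith
      calc _ ≤ 1 * (n : ℝ) ^ (-(2 * η)) := by gcongr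
        _ ≤ _ := by linarith [Real.rpow_pos_of_pos hn0 (-(2 * η))]
  have hlog : 1 + Real.log n ≤ (1 + 1 / η) * (n : ℝ) ^ η := by
    have h1 := Real.log_le_rpow_div hn0.le hη0
    have h2 : 1 ≤ (n : ℝ) ^ η := Real.one_le_rpow hn1 hη0.le
    calc 1 + Real.log n ≤ (n : ℝ) ^ η + (n : ℝ) ^ η / η := add_le_add h2 h1
      _ = _ := by ring
  have hharm : ∑ i ∈ Finset.Icc 1 n, (i : ℝ)⁻¹ ≤ 1 + Real.log n := by
    have := harmonic_le_one_add_log n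
    rw [harmonic_eq_sum_Icc] at this
    simpa using this
  calc _ ≤ ∑ i ∈ Finset.Icc 1 n, (i : ℝ)⁻¹ * (2 * (n : ℝ) ^ (-(2 * η))) := Finset.sum_le_sum hterm
    _ = (∑ i ∈ Finset.Icc 1 n, (i : ℝ)⁻¹) * (2 * (n : ℝ) ^ (-(2 * η))) := by rw [Finset.sum_mul]
    _ ≤ ((1 + 1 / η) * (n : ℝ) ^ η) * (2 * (n : ℝ) ^ (-(2 * η))) := by
        gcongr
        exact hharm.trans hlog
    _ = 2 * (1 + 1 / η) * ((n : ℝ) ^ η * (n : ℝ) ^ (-(2 * η))) := by ring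
    _ = _ := by rw [← Real.rpow_add hn0]; ring_nf

end Weights

/-- The choice of the parameter in the exponential bound makes it of order `n ^ (-r)`. -/
theorem exp_bound_le_rpow {r ε η B : ℝ} (hr : 0 < r) (hε : 0 < ε) (hη : 0 < η) (hB : 0 ≤ B) :
    ∃ K : ℝ, 0 ≤ K ∧ ∀ n : ℕ, 1 ≤ n → ∀ s : ℝ, 0 ≤ s → s ≤ B * (n : ℝ) ^ (-η) →
      Real.exp (-(r / ε * Real.log n * ε) + (r / ε * Real.log n * s
        + (r / ε * Real.log n) ^ 2 * Real.exp (r / ε * Real.log n * (η * ε / (2 * r))) * s))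
      ≤ K * (n : ℝ) ^ (-r) := by
  -- The logarithm is bounded through `n^(η/4)`: its square costs `n^(η/2)` and the exponential
  -- factor another `n^(η/2)`, together exactly what `s ≤ B n^(-η)` pays for.
  set L := r / ε * (1 / (η / 4)) with hL
  have hL0 : 0 ≤ L := by positivity
  refine ⟨Real.exp (L * B + L ^ 2 * B), (Real.exp_pos _).le, fun n hn s hs0 hs => ?_⟩
  have hn1 : (1 : ℝ) ≤ n := by exact_mod_cast hn
  have hn0 : (0 : ℝ) < n := by linarith
  set l := r / ε * Real.log n with hl
  have hl0 : 0 ≤ l := mul_nonneg (by positivity) (Real.log_nonneg hn1)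
  have hlL : l ≤ L * (n : ℝ) ^ (η / 4) := by
    have := Real.log_le_rpow_div hn0.le (by positivity : 0 < η / 4)
    calc l ≤ r / ε * ((n : ℝ) ^ (η / 4) / (η / 4)) := by rw [hl]; gcongr
      _ = _ := by rw [hL]; ring
  have e1 : -(l * ε) = -r * Real.log n := by rw [hl]; field_simp
  have e2 : Real.exp (l * (η * ε / (2 * r))) = (n : ℝ) ^ (η / 2) := by
    rw [Real.rpow_def_of_pos hn0]
    congr 1
    rw [hl]; field_simp
  have hle1 : ∀ x : ℝ, x ≤ 0 → (n : ℝ) ^ x ≤ 1 := fun x hx =>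
    Real.rpow_le_one_of_one_le_of_nonpos hn1 hx
  have b1 : l * s ≤ L * B := by
    calc l * s ≤ (L * (n : ℝ) ^ (η / 4)) * (B * (n : ℝ) ^ (-η)) := by gcongr
      _ = L * B * (n : ℝ) ^ (η / 4 + -η) := by rw [Real.rpow_add hn0]; ring
      _ ≤ L * B * 1 := by gcongr; exact hle1 _ (by linarith)
      _ = _ := mul_one _
  have b2 : l ^ 2 * (n : ℝ) ^ (η / 2) * s ≤ L ^ 2 * B := by
    calc l ^ 2 * (n : ℝ) ^ (η / 2) * s
        ≤ (L * (n : ℝ) ^ (η / 4)) ^ 2 * (n : ℝ) ^ (η / 2) * (B * (n : ℝ) ^ (-η)) := by gcongr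
      _ = L ^ 2 * B * (n : ℝ) ^ (η / 4 + η / 4 + η / 2 + -η) := by
          rw [Real.rpow_add hn0, Real.rpow_add hn0, Real.rpow_add hn0]; ring
      _ ≤ L ^ 2 * B * 1 := by gcongr; exact hle1 _ (by linarith)
      _ = _ := mul_one _
  have e3 : (n : ℝ) ^ (-r) = Real.exp (-r * Real.log n) := by
    rw [Real.rpow_def_of_pos hn0, mul_comm]
  rw [e1, e2, e3, ← Real.exp_add, Real.exp_le_exp]
  linarith

/-- The product is at most `exp (-G)` with `G` the sum, and `exp (-G) ≤ 1/(1+G)`. A product of at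
least `1/2` forces `G ≤ 1`, and on `[0, 1]` one has `1/(1+G) ≤ 1 - G/2`. -/
theorem sum_le_two_mul_one_sub_prod {ι : Type*} (s : Finset ι) {g : ι → ℝ} (h0 : ∀ i ∈ s, 0 ≤ g i)
    (h1 : ∀ i ∈ s, g i ≤ 1) (h : 1 - ∏ i ∈ s, (1 - g i) ≤ 1 / 2) :
    ∑ i ∈ s, g i ≤ 2 * (1 - ∏ i ∈ s, (1 - g i)) := by
  set G := ∑ i ∈ s, g i
  have hG0 : 0 ≤ G := Finset.sum_nonneg h0
  have hprod : ∏ i ∈ s, (1 - g i) ≤ Real.exp (-G) := by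
    rw [← Finset.sum_neg_distrib, Real.exp_sum]
    exact Finset.prod_le_prod (fun i hi => by linarith [h1 i hi])
      fun i _ => by linarith [Real.add_one_le_exp (-g i)]
  have hinv : Real.exp (-G) * Real.exp G = 1 := by rw [← Real.exp_add]; simp
  have hGe := Real.add_one_le_exp G
  have hpos := Real.exp_pos (-G)
  have hG1 : G ≤ 1 := by
    by_contra hlt
    nlinarith
  have : Real.exp (-G) ≤ 1 - G / 2 := by
    have h2 : Real.exp (-G) * (G + 1) ≤ 1 := by nlinarith
    by_contra hlt
    nlinarith
  linarith

theorem ENNReal.tsum_pnat_lt_top_iff {f : ℕ → ℝ≥0∞} (h0 : f 0 < ⊤) :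
    ∑' n : ℕ+, f n < ⊤ ↔ ∑' n : ℕ, f n < ⊤ := by
  rw [tsum_pnat_eq_tsum_succ (f := f), tsum_eq_zero_add' (f := f) ENNReal.summable, ENNReal.add_lt_top]
  simp [h0]

theorem lt_maxWeightedSum_iff {Ω : Type*} {a : ℕ → ℕ → ℝ} {X : ℕ → Ω → ℝ} {n : ℕ+} {ω : Ω} {ε : ℝ} :
    ε < maxWeightedSum a X n ω
      ↔ ∃ j ∈ Finset.Icc 1 (n : ℕ), ε < |∑ i ∈ Finset.Icc 1 j, a n i * X i ω| :=
  Finset.lt_sup'_iff _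

/-! ### From the tail series to complete convergence. -/

namespace SublinearExpectationSpace

variable {Ω : Type*}

/-- The event that some weighted partial sum with at most `n` terms exceeds `ε`. -/
def sumEvent (a : ℕ → ℕ → ℝ) (Xs : ℕ → Ω → ℝ) (ε : ℝ) (n : ℕ) : Set Ω :=
  {ω | ∃ j ∈ Finset.Icc 1 n, ε < |∑ i ∈ Finset.Icc 1 j, a n i * Xs i ω|}

/-- Either some summand is large, or a sum of truncated summands is large. -/
theorem sumEvent_subset {Xs : ℕ → Ω → ℝ} {a : ℕ → ℕ → ℝ} (δ ε : ℝ) (n : ℕ) {α : ℕ → ℝ} (hα : ∀ i ∈ Finset.Icc 1 n, α i = a n i) :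
    sumEvent a Xs ε n ⊆ (⋃ i ∈ Finset.Icc 1 n, {ω | δ < |a n i * Xs i ω|}) ∪
      ({ω | ∃ j ≤ n, ε < ∑ i ∈ Finset.Icc 1 j, 1 * clip δ (α i * Xs i ω)} ∪
        {ω | ∃ j ≤ n, ε < ∑ i ∈ Finset.Icc 1 j, -1 * clip δ (α i * Xs i ω)}) := by
  rintro ω ⟨j, hj, hlt⟩
  by_cases h : ∃ i ∈ Finset.Icc 1 n, δ < |a n i * Xs i ω|
  · obtain ⟨i, hi, h⟩ := h
    exact Or.inl (Set.mem_biUnion (show i ∈ (Finset.Icc 1 n : Set ℕ) from hi) h)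
  · right
    push Not at h
    have hsum : ∑ i ∈ Finset.Icc 1 j, a n i * Xs i ω
        = ∑ i ∈ Finset.Icc 1 j, clip δ (α i * Xs i ω) := by
      refine Finset.sum_congr rfl fun i hi => ?_
      have hi' : i ∈ Finset.Icc 1 n := Finset.Icc_subset_Icc_right (Finset.mem_Icc.1 hj).2 hi
      rw [hα i hi', clip_of_abs_le (h i hi')]
    rw [hsum] at hlt
    rcases lt_abs.1 hlt with h1 | h1
    · left
      exact ⟨j, (Finset.mem_Icc.1 hj).2, by simpa using h1⟩
    · right
      exact ⟨j, (Finset.mem_Icc.1 hj).2, by simpa using h1⟩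

variable [MeasurableSpace Ω] {S : SublinearExpectationSpace Ω}

theorem tail_eq_of_identDistributed {X Y : Ω → ℝ} (hX : X ∈ S.H) (hY : Y ∈ S.H)
    (h : IdentDistributed S S (fun _ : Fin 1 => X) (fun _ : Fin 1 => Y)) (t : ℝ) :
    S.er ({ω | t < |X ω|}.indicator fun _ => 1) = S.er ({ω | t < |Y ω|}.indicator fun _ => 1) := by
  have hm : ∀ {Z : Ω → ℝ}, Z ∈ S.H → MeasurableSet {ω | t < |Z ω|} := fun hZ =>
    measurableSet_lt measurable_const (S.measurable_of_mem _ hZ).abs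
  exact IdentDistributed.er_eq h (φ := {x : ℝ | t < |x|}.indicator fun _ => 1)
    (measurable_const.indicator (measurableSet_lt measurable_const measurable_id.abs))
    (Bounded.indicator (hm hX)) (Bounded.indicator (hm hY))

theorem tsum_atomWeight_mul (r p β c : ℝ) (g : ℝ → ℝ≥0∞) (n : ℕ) :
    ∑' i : ℕ, atomWeight r n i * g (c * ((n : ℝ) ^ (p + β) * (i : ℝ) ^ (-β)))
      = ENNReal.ofReal ((n : ℝ) ^ (r - 2))
        * ∑ i ∈ Finset.Icc 1 n, g (c * ((n : ℝ) ^ (p + β) * (i : ℝ) ^ (-β))) := by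
  rw [tsum_eq_sum (s := Finset.Icc 1 n) fun i hi => ?_, Finset.mul_sum]
  · refine Finset.sum_congr rfl fun i hi => ?_
    rw [atomWeight, if_pos (Finset.mem_Icc.1 hi)]
  · rw [Finset.mem_Icc] at hi
    simp [atomWeight, hi]

section Direct

variable {X : Ω → ℝ} {Xs : ℕ → Ω → ℝ} {a : ℕ → ℕ → ℝ}

theorem measurableSet_exists_lt_sum_clip (hXs : ∀ n, 1 ≤ n → Xs n ∈ S.H) (s δ ε : ℝ) (α : ℕ → ℝ)
    (n : ℕ) : MeasurableSet {ω | ∃ j ≤ n, ε < ∑ i ∈ Finset.Icc 1 j, s * clip δ (α i * Xs i ω)} := by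
  have : {ω | ∃ j ≤ n, ε < ∑ i ∈ Finset.Icc 1 j, s * clip δ (α i * Xs i ω)}
      = ⋃ j, ⋃ (_ : j ≤ n), {ω | ε < ∑ i ∈ Finset.Icc 1 j, s * clip δ (α i * Xs i ω)} := by
    ext; simp
  rw [this]
  refine MeasurableSet.iUnion fun j => MeasurableSet.iUnion fun _ =>
    measurableSet_lt measurable_const (Finset.measurable_sum _ fun i hi => ?_)
  exact measurable_const.mul ((measurable_clip δ).comp
    (measurable_const.mul (S.measurable_of_mem _ (hXs i (Finset.mem_Icc.1 hi).1))))

/-- For large `n`, the capacity of `sumEvent` is controlled by the tails of the summands. -/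
theorem exists_capacity_sumEvent_le (hS : S.CountablySubadditive) (hX : X ∈ S.H)
    (hXs : ∀ n, 1 ≤ n → Xs n ∈ S.H) (hindep : S.IndepSeq Xs)
    (hident : ∀ n, 1 ≤ n → IdentDistributed S S (fun _ : Fin 1 => Xs n) (fun _ : Fin 1 => X))
    {r p β : ℝ} (hr : 0 < r) (hβ : 0 < β + p) {C : ℝ} (hC : 0 < C) {N : ℕ}
    (ha0 : ∀ n, N ≤ n → ∀ i, 1 ≤ i → i ≤ n → 0 < a n i)
    (ha : ∀ n, N ≤ n → ∀ i, 1 ≤ i → i ≤ n →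
      a n i ≤ C * ((n : ℝ) ^ (p + β) * (i : ℝ) ^ (-β))⁻¹)
    {K q : ℝ} (hg : ∀ t, 0 < t → S.er ({ω | t < |X ω|}.indicator fun _ => 1) ≤ K * t ^ (-q))
    (hq0 : 0 < q) (hq2 : q < 2) (hpq : 1 < p * q)
    (hq : q < 1 ∨ 1 < q ∧ S.E X = 0 ∧ S.E (fun ω => -X ω) = 0) {ε : ℝ} (hε : 0 < ε) :
    ∃ c : ℝ, 0 < c ∧ ∃ A : ℝ, 0 ≤ A ∧ ∀ n, N ≤ n → 2 ≤ n → S.capacity (sumEvent a Xs ε n)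
      ≤ ∑ i ∈ Finset.Icc 1 n, S.capacity {ω | c * ((n : ℝ) ^ (p + β) * (i : ℝ) ^ (-β)) < |X ω|}
        + ENNReal.ofReal (A * (n : ℝ) ^ (-r)) := by
  obtain ⟨η, hη, C₀, hC₀, hrow⟩ := exists_sum_weight_rpow_le (p := p) hβ hq0 hpq
  -- With parameter `l = (r/ε) log n` this level gives `exp (l δ) = n^(η/2)`, which the row sums
  -- `O(n^(-η))` can absorb.
  set δ := η * ε / (2 * r) with hδdef
  have hδ : 0 < δ := by positivity
  obtain ⟨M₁, hM₁⟩ := hS.exists_er_clip_le hX hg hδ hq (s := 1) (Or.inl rfl)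
  obtain ⟨M₂, hM₂⟩ := hS.exists_er_clip_le hX hg hδ hq (s := -1) (Or.inr rfl)
  obtain ⟨M₃, hM₃⟩ := hS.exists_er_truncated_pow_le hX hg hδ (θ := 2) two_ne_zero (by exact_mod_cast hq2)
  set M := |M₁| + |M₂| + |M₃| with hM
  have hM0 : 0 ≤ M := by positivity
  obtain ⟨A, hA, hexp⟩ := exp_bound_le_rpow (r := r) (ε := ε) (η := η) (B := M * C ^ q * C₀)
    hr hε hη (by positivity)
  refine ⟨δ / C, by positivity, 2 * A, by positivity, fun n hNn hn => ?_⟩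
  have hn1 : 1 ≤ n := by omega
  have hn1' : (1 : ℝ) < n := by exact_mod_cast hn
  -- The maximal inequality asks for moment bounds at every index, whereas the weights are
  -- controlled only for `1 ≤ i ≤ n`; outside they are set to zero. The one sequence `m` bounds both
  -- first and second moments.
  let α : ℕ → ℝ := fun i => if i ∈ Finset.Icc 1 n then a n i else 0
  let m : ℕ → ℝ := fun i => if i ∈ Finset.Icc 1 n then M * a n i ^ q else 0
  have hapos : ∀ i ∈ Finset.Icc 1 n, 0 < a n i := fun i hi =>
    ha0 n hNn i (Finset.mem_Icc.1 hi).1 (Finset.mem_Icc.1 hi).2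
  have hm0 : ∀ i, 0 ≤ m i := fun i => by
    by_cases hi : i ∈ Finset.Icc 1 n
    · have := hapos i hi
      simp only [m, if_pos hi]; positivity
    · simp only [m, if_neg hi]; rfl
  have hsum : ∑ i ∈ Finset.Icc 1 n, m i ≤ M * C ^ q * C₀ * (n : ℝ) ^ (-η) := by
    calc ∑ i ∈ Finset.Icc 1 n, m i = ∑ i ∈ Finset.Icc 1 n, M * a n i ^ q :=
          Finset.sum_congr rfl fun i hi => if_pos hi
      _ ≤ ∑ i ∈ Finset.Icc 1 n, M * C ^ q * (((n : ℝ) ^ (p + β) * (i : ℝ) ^ (-β))⁻¹) ^ q := by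
          refine Finset.sum_le_sum fun i hi => ?_
          rw [mul_assoc, ← Real.mul_rpow hC.le (by positivity)]
          have h1 := hapos i hi
          gcongr
          exact ha n hNn i (Finset.mem_Icc.1 hi).1 (Finset.mem_Icc.1 hi).2
      _ = M * C ^ q * ∑ i ∈ Finset.Icc 1 n, (((n : ℝ) ^ (p + β) * (i : ℝ) ^ (-β))⁻¹) ^ q := by
          rw [Finset.mul_sum]
      _ ≤ M * C ^ q * (C₀ * (n : ℝ) ^ (-η)) := by
          gcongr
          exact hrow n hn1
      _ = _ := by ring
  have hclip0 : clip δ 0 = 0 := clip_of_abs_le (by simpa using hδ.le)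
  have hmean : ∀ s : ℝ, s = 1 ∨ s = -1 → ∀ i, 1 ≤ i →
      S.er (fun ω => s * clip δ (α i * Xs i ω)) ≤ m i := by
    intro s hs i hi1
    by_cases hi : i ∈ Finset.Icc 1 n
    · simp only [α, m, if_pos hi]
      rw [IdentDistributed.er_eq (hident i hi1) (φ := fun x => s * clip δ (a n i * x))
        (measurable_const.mul ((measurable_clip δ).comp (measurable_const.mul measurable_id)))
        ((clip_bounded (hXs i hi1) hδ.le _).const_mul s)
        ((clip_bounded hX hδ.le _).const_mul s)]
      have hp := Real.rpow_nonneg (hapos i hi).le q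
      rcases hs with rfl | rfl
      · refine (hM₁ _ (hapos i hi)).trans (mul_le_mul_of_nonneg_right ?_ hp)
        linarith [le_abs_self M₁, abs_nonneg M₂, abs_nonneg M₃]
      · refine (hM₂ _ (hapos i hi)).trans (mul_le_mul_of_nonneg_right ?_ hp)
        linarith [le_abs_self M₂, abs_nonneg M₁, abs_nonneg M₃]
    · simp only [α, m, if_neg hi, zero_mul, hclip0, mul_zero, er_const]; rfl
  have hvar : ∀ i, 1 ≤ i → S.er (fun ω => |clip δ (α i * Xs i ω)| ^ 2) ≤ m i := by
    intro i hi1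
    by_cases hi : i ∈ Finset.Icc 1 n
    · simp only [α, m, if_pos hi]
      have hb : ∀ {Z : Ω → ℝ}, Z ∈ S.H → S.Bounded fun ω => |clip δ (a n i * Z ω)| ^ 2 :=
        fun hZ => by simpa [sq] using (clip_bounded hZ hδ.le (a n i)).mul (clip_bounded hZ hδ.le _)
      rw [IdentDistributed.er_eq (hident i hi1) (φ := fun x => |clip δ (a n i * x)| ^ 2)
        (((measurable_clip δ).comp (measurable_const.mul measurable_id)).abs.pow_const 2)
        (hb (hXs i hi1)) (hb hX)]
      refine (hM₃ _ (hapos i hi)).trans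
        (mul_le_mul_of_nonneg_right ?_ (Real.rpow_nonneg (hapos i hi).le q))
      linarith [le_abs_self M₃, abs_nonneg M₁, abs_nonneg M₂]
    · simp only [α, m, if_neg hi, zero_mul, hclip0, abs_zero, ne_eq, OfNat.ofNat_ne_zero,
        not_false_eq_true, zero_pow, er_const]
      rfl
  have hl : 0 < r / ε * Real.log n := mul_pos (by positivity) (Real.log_pos hn1')
  have hside : ∀ s : ℝ, s = 1 ∨ s = -1 →
      S.capacity {ω | ∃ j ≤ n, ε < ∑ i ∈ Finset.Icc 1 j, s * clip δ (α i * Xs i ω)}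
        ≤ ENNReal.ofReal (A * (n : ℝ) ^ (-r)) := by
    intro s hs
    refine (hindep.capacity_exists_lt_sum_clip_le hXs hs hδ.le hm0 hm0 (hmean s hs) hvar hl ε n).trans
      (ENNReal.ofReal_le_ofReal ?_)
    rw [Finset.sum_add_distrib, ← Finset.mul_sum, ← Finset.mul_sum]
    exact hexp n hn1 _ (Finset.sum_nonneg fun i _ => hm0 i) hsum
  have hbig : ∀ i ∈ Finset.Icc 1 n, MeasurableSet {ω | δ < |a n i * Xs i ω|} := fun i hi =>
    measurableSet_lt measurable_const (measurable_const.mul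
      (S.measurable_of_mem _ (hXs i (Finset.mem_Icc.1 hi).1))).abs
  have hmeas := fun s => measurableSet_exists_lt_sum_clip hXs s δ ε α n
  refine (capacity_mono (sumEvent_subset δ ε n (α := α) fun i hi => if_pos hi)).trans ?_
  refine (capacity_union_le (Finset.measurableSet_biUnion _ hbig)
    ((hmeas 1).union (hmeas (-1)))).trans ?_
  refine add_le_add ((capacity_biUnion_le _ hbig).trans (Finset.sum_le_sum fun i hi => ?_)) ?_
  · obtain ⟨hi1, hin⟩ := Finset.mem_Icc.1 hi
    have hm : ∀ {Z : Ω → ℝ}, Z ∈ S.H →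
        MeasurableSet {ω | δ / C * ((n : ℝ) ^ (p + β) * (i : ℝ) ^ (-β)) < |Z ω|} := fun hZ =>
      measurableSet_lt measurable_const (S.measurable_of_mem _ hZ).abs
    rw [capacity_eq_er (hm hX), ← tail_eq_of_identDistributed (hXs i hi1) hX (hident i hi1),
      ← capacity_eq_er (hm (hXs i hi1))]
    refine capacity_mono fun ω (hω : δ < _) => ?_
    have hn0 : (0 : ℝ) < n := by linarith
    have hi0 : (0 : ℝ) < i := by exact_mod_cast hi1
    set b := (n : ℝ) ^ (p + β) * (i : ℝ) ^ (-β) with hb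
    have hb0 : 0 < b := by positivity
    have h1 : |a n i * Xs i ω| ≤ C * b⁻¹ * |Xs i ω| := by
      rw [abs_mul, abs_of_pos (hapos i hi)]
      gcongr
      exact ha n hNn i hi1 hin
    have h2 : δ < C * b⁻¹ * |Xs i ω| := hω.trans_le h1
    show δ / C * b < |Xs i ω|
    rw [div_mul_eq_mul_div, div_lt_iff₀ hC]
    calc δ * b < C * b⁻¹ * |Xs i ω| * b := by gcongr
      _ = |Xs i ω| * C := by field_simp
  · refine (capacity_union_le (hmeas 1) (hmeas (-1))).trans ?_
    have hAn : 0 ≤ A * (n : ℝ) ^ (-r) := by positivity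
    rw [mul_assoc, two_mul, ENNReal.ofReal_add hAn hAn]
    exact add_le_add (hside 1 (Or.inl rfl)) (hside (-1) (Or.inr rfl))

theorem tsum_capacity_sumEvent_lt_top {r p β c A : ℝ} {g : ℝ → ℝ≥0∞} {N : ℕ} {ε : ℝ}
    (hA : 0 ≤ A) (hg : tailSeries r p β c g < ⊤)
    (h : ∀ n, N ≤ n → S.capacity (sumEvent a Xs ε n)
      ≤ ∑ i ∈ Finset.Icc 1 n, g (c * ((n : ℝ) ^ (p + β) * (i : ℝ) ^ (-β)))
        + ENNReal.ofReal (A * (n : ℝ) ^ (-r))) :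
    ∑' n : ℕ, ENNReal.ofReal ((n : ℝ) ^ (r - 2)) * S.capacity (sumEvent a Xs ε n) < ⊤ := by
  have hsum2 : ∑' n : ℕ, ENNReal.ofReal (A * (n : ℝ) ^ (-2 : ℝ)) < ⊤ := by
    rw [← ENNReal.ofReal_tsum_of_nonneg (fun n => by positivity)
      ((Real.summable_nat_rpow.2 (by norm_num)).mul_left A)]
    exact ENNReal.ofReal_lt_top
  -- The cut at `N + 1` rather than `N` also removes `n = 0`, for which the manipulation of powers
  -- below fails.
  have hfin : ∑' n : ℕ, (if n < N + 1 then ENNReal.ofReal ((n : ℝ) ^ (r - 2)) else 0) < ⊤ := by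
    rw [tsum_eq_sum (s := Finset.range (N + 1)) fun n hn => if_neg (by simpa using hn)]
    refine ENNReal.sum_lt_top.2 fun n _ => ?_
    split_ifs
    · exact ENNReal.ofReal_lt_top
    · exact ENNReal.zero_lt_top
  refine lt_of_le_of_lt (ENNReal.tsum_le_tsum (g := fun n : ℕ =>
    (if n < N + 1 then ENNReal.ofReal ((n : ℝ) ^ (r - 2)) else 0)
      + (∑' i : ℕ, atomWeight r n i * g (c * ((n : ℝ) ^ (p + β) * (i : ℝ) ^ (-β)))
        + ENNReal.ofReal (A * (n : ℝ) ^ (-2 : ℝ)))) fun n => ?_) ?_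
  · split_ifs with hn
    · refine le_add_right ?_
      exact mul_le_of_le_one_right' (capacity_le_one _)
    · rw [zero_add, tsum_atomWeight_mul]
      have hn0 : (0 : ℝ) < n := by exact_mod_cast (by omega : 0 < n)
      have e : A * (n : ℝ) ^ (-2 : ℝ) = (n : ℝ) ^ (r - 2) * (A * (n : ℝ) ^ (-r)) := by
        rw [mul_left_comm, ← Real.rpow_add hn0]; ring_nf
      rw [e, ENNReal.ofReal_mul (by positivity), ← mul_add]
      gcongr
      exact h n (by omega)
  · rw [ENNReal.tsum_add, ENNReal.tsum_add]
    exact ENNReal.add_lt_top.2 ⟨hfin, ENNReal.add_lt_top.2 ⟨hg, hsum2⟩⟩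

end Direct

end SublinearExpectationSpace

/-! ### From complete convergence to the tail series. -/

namespace SublinearExpectationSpace

variable {Ω : Type*}

/-- The event that one of the first `n` variables exceeds its threshold. -/
def largeEvent (p β c : ℝ) (Xs : ℕ → Ω → ℝ) (n : ℕ) : Set Ω :=
  {ω | ∃ i ∈ Finset.Icc 1 n, c * ((n : ℝ) ^ (p + β) * (i : ℝ) ^ (-β)) < |Xs i ω|}

/-- A summand is the difference of two consecutive partial sums, whence the factor 2; for `i = 1`
the earlier sum is empty and vanishes. -/
theorem largeEvent_subset_sumEvent {p β c C : ℝ} (hC : 0 < C) {a : ℕ → ℕ → ℝ} {Xs : ℕ → Ω → ℝ}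
    {n : ℕ} (ha : ∀ i, 1 ≤ i → i ≤ n → ((n : ℝ) ^ (p + β) * (i : ℝ) ^ (-β))⁻¹ ≤ C * a n i) :
    largeEvent p β c Xs n ⊆ sumEvent a Xs (c / (2 * C)) n := by
  rintro ω ⟨i, hi, hlt⟩
  obtain ⟨hi1, hin⟩ := Finset.mem_Icc.1 hi
  by_contra hnot
  have hle : ∀ j ≤ n, |∑ i ∈ Finset.Icc 1 j, a n i * Xs i ω| ≤ c / (2 * C) ∨ j = 0 := by
    intro j hj
    rcases Nat.eq_zero_or_pos j with h0 | h0
    · exact Or.inr h0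
    · exact Or.inl (not_lt.1 fun h => hnot ⟨j, Finset.mem_Icc.2 ⟨h0, hj⟩, h⟩)
  have hci : |∑ k ∈ Finset.Icc 1 i, a n k * Xs k ω| ≤ c / (2 * C) :=
    (hle i hin).resolve_right (by omega)
  have hci' : |∑ k ∈ Finset.Icc 1 (i - 1), a n k * Xs k ω| ≤ c / (2 * C) := by
    rcases hle (i - 1) (by omega) with h | h
    · exact h
    · simpa [h] using (abs_nonneg _).trans hci
  have hsplit : ∑ k ∈ Finset.Icc 1 i, a n k * Xs k ω
      = ∑ k ∈ Finset.Icc 1 (i - 1), a n k * Xs k ω + a n i * Xs i ω := by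
    obtain ⟨j, rfl⟩ : ∃ j, i = j + 1 := ⟨i - 1, by omega⟩
    rw [Finset.sum_Icc_succ_top (by omega), Nat.add_sub_cancel]
  have hax : |a n i * Xs i ω| ≤ c / C := by
    have : a n i * Xs i ω = ∑ k ∈ Finset.Icc 1 i, a n k * Xs k ω
        - ∑ k ∈ Finset.Icc 1 (i - 1), a n k * Xs k ω := by rw [hsplit]; ring
    rw [this]
    refine (abs_sub _ _).trans ((add_le_add hci hci').trans (le_of_eq ?_))
    field_simp
    norm_num
  have hn0 : (0 : ℝ) < n := by exact_mod_cast (by omega : 0 < n)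
  have hi0 : (0 : ℝ) < i := by exact_mod_cast hi1
  set b := (n : ℝ) ^ (p + β) * (i : ℝ) ^ (-β) with hb
  have hb0 : 0 < b := by positivity
  have ha' := ha i hi1 hin
  have ha0 : 0 < a n i := by
    by_contra h
    have h1 : 0 < b⁻¹ := by positivity
    nlinarith
  rw [abs_mul, abs_of_pos ha0, le_div_iff₀ hC] at hax
  have h2 : 1 ≤ C * a n i * b := by
    have := mul_le_mul_of_nonneg_right ha' hb0.le
    rwa [inv_mul_cancel₀ hb0.ne'] at this
  have h3 : |Xs i ω| ≤ C * a n i * b * |Xs i ω| := le_mul_of_one_le_left (abs_nonneg _) h2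
  have h4 : a n i * |Xs i ω| * C * b ≤ c * b := mul_le_mul_of_nonneg_right hax hb0.le
  linarith

/-- The thresholds grow by at most `2^(p+β)` when `n` at most doubles. This makes the events nearly
monotone in `n`, as summing over a dyadic block requires. -/
theorem largeEvent_subset_of_le {p β c : ℝ} (hβ : 0 < β + p) (hc : 0 ≤ c) (Xs : ℕ → Ω → ℝ)
    {n m : ℕ} (hnm : n ≤ m) (hm : m ≤ 2 * n) :
    largeEvent p β c Xs n ⊆ largeEvent p β (c * 2 ^ (-(p + β))) Xs m := by
  rintro ω ⟨i, hi, hlt⟩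
  refine ⟨i, Finset.Icc_subset_Icc_right hnm hi, lt_of_le_of_lt ?_ hlt⟩
  have hpb : 0 < p + β := by linarith
  have h1 : (m : ℝ) ^ (p + β) ≤ 2 ^ (p + β) * (n : ℝ) ^ (p + β) := by
    rw [← Real.mul_rpow two_pos.le (Nat.cast_nonneg n)]
    gcongr
    exact_mod_cast hm
  calc c * 2 ^ (-(p + β)) * ((m : ℝ) ^ (p + β) * (i : ℝ) ^ (-β))
      ≤ c * 2 ^ (-(p + β)) * (2 ^ (p + β) * (n : ℝ) ^ (p + β) * (i : ℝ) ^ (-β)) := by gcongr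
    _ = c * (2 ^ (-(p + β)) * 2 ^ (p + β)) * ((n : ℝ) ^ (p + β) * (i : ℝ) ^ (-β)) := by ring
    _ = _ := by rw [← Real.rpow_add two_pos, neg_add_cancel, Real.rpow_zero, mul_one]

variable [MeasurableSpace Ω] {S : SublinearExpectationSpace Ω}

/-- Convergence of the series forces the capacities of large summands to be small eventually. -/
theorem eventually_capacity_largeEvent_le {r p β c C : ℝ} (hr : 1 < r) (hβ : 0 < β + p)
    (hc : 0 < c) (hC : 0 < C) {a : ℕ → ℕ → ℝ} {Xs : ℕ → Ω → ℝ} {N : ℕ}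
    (ha : ∀ n, N ≤ n → ∀ i, 1 ≤ i → i ≤ n →
      ((n : ℝ) ^ (p + β) * (i : ℝ) ^ (-β))⁻¹ ≤ C * a n i)
    (h : ∀ ε : ℝ, 0 < ε →
      ∑' n : ℕ, ENNReal.ofReal ((n : ℝ) ^ (r - 2)) * S.capacity (sumEvent a Xs ε n) < ⊤) :
    ∀ᶠ n : ℕ in Filter.atTop, S.capacity (largeEvent p β c Xs n) ≤ ENNReal.ofReal (1 / 2) := by
  have hsum := h (c * 2 ^ (-(p + β)) / (2 * C)) (by positivity)
  set total := ∑' n : ℕ, ENNReal.ofReal ((n : ℝ) ^ (r - 2))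
    * S.capacity (sumEvent a Xs (c * 2 ^ (-(p + β)) / (2 * C)) n)
  have hlim : Filter.Tendsto (fun n : ℕ => 2 ^ (-|r - 2|) * (n : ℝ) ^ (r - 1))
      Filter.atTop Filter.atTop :=
    ((tendsto_rpow_atTop (by linarith)).comp tendsto_natCast_atTop_atTop).const_mul_atTop
      (by positivity)
  filter_upwards [hlim.eventually_ge_atTop (2 * total.toReal + 1), Filter.eventually_ge_atTop N,
    Filter.eventually_ge_atTop 1] with n hn hN hn1
  have hn0 : (0 : ℝ) < n := by exact_mod_cast hn1
  -- Every term of the series with `n ≤ m ≤ 2n` dominates the same quantity, so the block gives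
  -- `n^(r-1) V ≤ const * total`; since `r > 1`, `V` falls below `1/2`.
  have hterm : ∀ m ∈ Finset.Icc n (2 * n),
      ENNReal.ofReal (2 ^ (-|r - 2|) * (n : ℝ) ^ (r - 2)) * S.capacity (largeEvent p β c Xs n)
      ≤ ENNReal.ofReal ((m : ℝ) ^ (r - 2))
        * S.capacity (sumEvent a Xs (c * 2 ^ (-(p + β)) / (2 * C)) m) := by
    intro m hm
    obtain ⟨h1, h2⟩ := Finset.mem_Icc.1 hm
    refine mul_le_mul' (ENNReal.ofReal_le_ofReal ?_) (capacity_mono ?_)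
    · have h1' : (n : ℝ) ≤ m := by exact_mod_cast h1
      have h2' : (m : ℝ) ≤ 2 * n := by exact_mod_cast h2
      rcases le_total 0 (r - 2) with h0 | h0
      · have h3 : (2 : ℝ) ^ (-|r - 2|) ≤ 1 := Real.rpow_le_one_of_one_le_of_nonpos one_le_two (by simp)
        exact (mul_le_of_le_one_left (by positivity) h3).trans (by gcongr)
      · rw [abs_of_nonpos h0, neg_neg, ← Real.mul_rpow two_pos.le hn0.le]
        exact Real.rpow_le_rpow_of_nonpos (by linarith) h2' h0
    · exact (largeEvent_subset_of_le hβ hc.le Xs h1 h2).trans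
        (largeEvent_subset_sumEvent hC (ha m (hN.trans h1)))
  have hle : ENNReal.ofReal (2 ^ (-|r - 2|) * (n : ℝ) ^ (r - 1))
      * S.capacity (largeEvent p β c Xs n) ≤ total := by
    calc _ = (n : ℝ≥0∞) * (ENNReal.ofReal (2 ^ (-|r - 2|) * (n : ℝ) ^ (r - 2))
            * S.capacity (largeEvent p β c Xs n)) := by
          rw [← ENNReal.ofReal_natCast, ← mul_assoc, ← ENNReal.ofReal_mul hn0.le]
          congr 2
          rw [show r - 1 = r - 2 + 1 by ring, Real.rpow_add_one hn0.ne']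
          ring
      _ ≤ ((Finset.Icc n (2 * n)).card : ℝ≥0∞) * (ENNReal.ofReal (2 ^ (-|r - 2|) * (n : ℝ) ^ (r - 2))
            * S.capacity (largeEvent p β c Xs n)) := by
          gcongr
          rw [Nat.card_Icc]; omega
      _ ≤ _ := by
          rw [← nsmul_eq_mul]
          exact (Finset.card_nsmul_le_sum _ _ _ hterm).trans (ENNReal.sum_le_tsum _)
  have hcap := capacity_le_one (S := S) (largeEvent p β c Xs n)
  have hfin : S.capacity (largeEvent p β c Xs n) ≠ ⊤ := ne_top_of_le_ne_top ENNReal.one_ne_top hcap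
  rw [← ENNReal.ofReal_toReal hfin, ← ENNReal.ofReal_mul (by positivity),
    ENNReal.ofReal_le_iff_le_toReal hsum.ne] at hle
  rw [← ENNReal.ofReal_toReal hfin]
  refine ENNReal.ofReal_le_ofReal ?_
  have h0 : 0 ≤ (S.capacity (largeEvent p β c Xs n)).toReal := ENNReal.toReal_nonneg
  have h1 := mul_le_mul_of_nonneg_right hn h0
  have h2 : 0 ≤ total.toReal := ENNReal.toReal_nonneg
  nlinarith

/-- A converse Borel–Cantelli estimate: by independence the capacity of the union is `1 - ∏ (1 - g
i)`, and a value of at most `1/2` controls the sum. -/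
theorem sum_tail_le_two_mul_capacity {X : Ω → ℝ} (hX : X ∈ S.H) {Xs : ℕ → Ω → ℝ}
    (hXs : ∀ n, 1 ≤ n → Xs n ∈ S.H) (hindep : S.IndepSeq Xs)
    (hident : ∀ n, 1 ≤ n → IdentDistributed S S (fun _ : Fin 1 => Xs n) (fun _ : Fin 1 => X))
    {p β c : ℝ} {n : ℕ}
    (h : S.capacity (largeEvent p β c Xs n) ≤ ENNReal.ofReal (1 / 2)) :
    ∑ i ∈ Finset.Icc 1 n, S.capacity {ω | c * ((n : ℝ) ^ (p + β) * (i : ℝ) ^ (-β)) < |X ω|}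
      ≤ 2 * S.capacity (largeEvent p β c Xs n) := by
  have hm : ∀ {Z : Ω → ℝ} (t : ℝ), Z ∈ S.H → MeasurableSet {ω | t < |Z ω|} := fun t hZ =>
    measurableSet_lt measurable_const (S.measurable_of_mem _ hZ).abs
  let g : ℕ → ℝ := fun i =>
    S.er ({ω | c * ((n : ℝ) ^ (p + β) * (i : ℝ) ^ (-β)) < |X ω|}.indicator fun _ => 1)
  have hg0 : ∀ i, 0 ≤ g i := fun i => er_nonneg (Bounded.indicator (hm _ hX))
    (Set.indicator_nonneg fun _ _ => zero_le_one)
  have hg1 : ∀ i, g i ≤ 1 := fun i => er_le_of_le (Bounded.indicator (hm _ hX)) fun ω =>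
    Set.indicator_le_self' (fun _ _ => zero_le_one) ω |>.trans le_rfl
  have heq : S.capacity (largeEvent p β c Xs n)
      = ENNReal.ofReal (1 - ∏ i ∈ Finset.Icc 1 n, (1 - g i)) := by
    have h1 := hindep.capacity_exists_mem_eq (fun i hi => S.measurable_of_mem _ (hXs i hi))
      (B := fun i => {x : ℝ | c * ((n : ℝ) ^ (p + β) * (i : ℝ) ^ (-β)) < |x|})
      (fun i => measurableSet_lt measurable_const measurable_id.abs) n
    refine Eq.trans h1 (congrArg (fun x => ENNReal.ofReal (1 - x)) (Finset.prod_congr rfl fun i hi => ?_))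
    have hi1 := (Finset.mem_Icc.1 hi).1
    exact congrArg (fun x => 1 - x) (tail_eq_of_identDistributed (hXs i hi1) hX (hident i hi1) _)
  rw [heq, ENNReal.ofReal_le_ofReal_iff (by norm_num)] at h
  have hsum := sum_le_two_mul_one_sub_prod (Finset.Icc 1 n) (fun i _ => hg0 i) (fun i _ => hg1 i) h
  calc _ = ENNReal.ofReal (∑ i ∈ Finset.Icc 1 n, g i) := by
        rw [ENNReal.ofReal_sum_of_nonneg fun i _ => hg0 i]
        exact Finset.sum_congr rfl fun i _ => capacity_eq_er (hm _ hX)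
    _ ≤ ENNReal.ofReal (2 * (1 - ∏ i ∈ Finset.Icc 1 n, (1 - g i))) := ENNReal.ofReal_le_ofReal hsum
    _ = _ := by rw [heq, ENNReal.ofReal_mul two_pos.le, ENNReal.ofReal_ofNat]

theorem tailSeries_lt_top_of_tsum_capacity_lt_top {X : Ω → ℝ} (hX : X ∈ S.H) {Xs : ℕ → Ω → ℝ}
    (hXs : ∀ n, 1 ≤ n → Xs n ∈ S.H) (hindep : S.IndepSeq Xs)
    (hident : ∀ n, 1 ≤ n → IdentDistributed S S (fun _ : Fin 1 => Xs n) (fun _ : Fin 1 => X))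
    {r p β C : ℝ} (hr : 1 < r) (hβ : 0 < β + p) (hC : 0 < C) {a : ℕ → ℕ → ℝ} {N : ℕ}
    (ha : ∀ n, N ≤ n → ∀ i, 1 ≤ i → i ≤ n →
      ((n : ℝ) ^ (p + β) * (i : ℝ) ^ (-β))⁻¹ ≤ C * a n i)
    (h : ∀ ε : ℝ, 0 < ε →
      ∑' n : ℕ, ENNReal.ofReal ((n : ℝ) ^ (r - 2)) * S.capacity (sumEvent a Xs ε n) < ⊤) :
    tailSeries r p β 1 (fun t => S.capacity {ω | t < |X ω|}) < ⊤ := by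
  obtain ⟨M, hM⟩ := Filter.eventually_atTop.1
    (eventually_capacity_largeEvent_le hr hβ one_pos hC ha h)
  have hfin : ∑' n : ℕ,
      (if n < max M N then ENNReal.ofReal ((n : ℝ) ^ (r - 2)) * n else 0) < ⊤ := by
    rw [tsum_eq_sum (s := Finset.range (max M N)) fun n hn => if_neg (by simpa using hn)]
    refine ENNReal.sum_lt_top.2 fun n _ => ?_
    split_ifs
    · exact ENNReal.mul_lt_top ENNReal.ofReal_lt_top (ENNReal.natCast_lt_top n)
    · exact ENNReal.zero_lt_top
  refine lt_of_le_of_lt (ENNReal.tsum_le_tsum (g := fun n : ℕ =>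
    (if n < max M N then ENNReal.ofReal ((n : ℝ) ^ (r - 2)) * n else 0)
      + 2 * (ENNReal.ofReal ((n : ℝ) ^ (r - 2)) * S.capacity (sumEvent a Xs (1 / (2 * C)) n)))
    fun n => ?_) ?_
  · rw [tsum_atomWeight_mul r p β 1 (fun t => S.capacity {ω | t < |X ω|})]
    split_ifs with hn
    · refine le_add_right ?_
      gcongr
      refine (Finset.sum_le_card_nsmul _ _ 1 fun i _ => capacity_le_one _).trans ?_
      simp
    · rw [not_lt, max_le_iff] at hn
      rw [zero_add, mul_left_comm]
      gcongr
      refine (sum_tail_le_two_mul_capacity hX hXs hindep hident (hM n hn.1)).trans ?_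
      gcongr
      exact capacity_mono (largeEvent_subset_sumEvent hC (ha n hn.2))
  · rw [ENNReal.tsum_add, ENNReal.tsum_mul_left]
    exact ENNReal.add_lt_top.2 ⟨hfin,
      ENNReal.mul_lt_top ENNReal.ofNat_lt_top (h _ (by positivity))⟩

/-! ### Assembly of the two implications. -/

/-- The complete convergence theorem, for a gauge `f` of the right growth. -/
theorem choquet_lt_top_iff_tsum_capacity (hS : S.CountablySubadditive) {X : Ω → ℝ} (hX : X ∈ S.H)
    {Xs : ℕ → Ω → ℝ} (hXs : ∀ n, 1 ≤ n → Xs n ∈ S.H) (hindep : S.IndepSeq Xs)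
    (hident : ∀ n, 1 ≤ n → IdentDistributed S S (fun _ : Fin 1 => Xs n) (fun _ : Fin 1 => X))
    {r p β : ℝ} (hr : 1 < r) (hp : 1 / 2 < p) (hβ : 0 < β + p)
    (hmean : p ≤ 1 → S.E X = 0 ∧ -S.E (fun ω => -X ω) = 0) {a : ℕ → ℕ → ℝ}
    (ha : ArrayApprox a (fun n i => ((i : ℝ) / (n : ℝ)) ^ β * (1 / (n : ℝ)) ^ p)) {f : ℝ → ℝ}
    (hf : IsIncreasingBijection f) (hG : GrowthComparable r p β f)
    (hlow : ∀ t, 1 ≤ t → Real.log 2 * t ^ (r / p) ≤ f t) :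
    S.choquet (fun ω => f |X ω|) < ⊤ ↔
      ∀ ε : ℝ, 0 < ε → ∑' n : ℕ+, ENNReal.ofReal ((n : ℝ) ^ (r - 2)) *
        S.capacity {ω | ε < maxWeightedSum a Xs n ω} < ⊤ := by
  obtain ⟨⟨C₁, hC₁, N₁, h₁⟩, C₂, hC₂, N₂, h₂⟩ := ha
  have hp0 : 0 < p := by linarith
  have hup : ∀ n, max N₁ N₂ ≤ n → ∀ i, 1 ≤ i → i ≤ n →
      a n i ≤ C₁ * ((n : ℝ) ^ (p + β) * (i : ℝ) ^ (-β))⁻¹ := fun n hn i hi hin => by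
    rw [← weight_eq (hi.trans hin) hi]
    exact h₁ n ((le_max_left _ _).trans hn) i hi hin
  have hdown : ∀ n, max N₁ N₂ ≤ n → ∀ i, 1 ≤ i → i ≤ n →
      ((n : ℝ) ^ (p + β) * (i : ℝ) ^ (-β))⁻¹ ≤ C₂ * a n i := fun n hn i hi hin => by
    rw [← weight_eq (hi.trans hin) hi]
    exact h₂ n ((le_max_right _ _).trans hn) i hi hin
  have hpos : ∀ n, max N₁ N₂ ≤ n → ∀ i, 1 ≤ i → i ≤ n → 0 < a n i := fun n hn i hi hin => by
    have hn0 : (0 : ℝ) < n := by exact_mod_cast (by omega : 0 < n)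
    have hi0 : (0 : ℝ) < i := by exact_mod_cast hi
    have h1 : 0 < ((n : ℝ) ^ (p + β) * (i : ℝ) ^ (-β))⁻¹ := by positivity
    have h2 := hdown n hn i hi hin
    by_contra hneg
    nlinarith
  have hev : ∀ (ε : ℝ) (n : ℕ+), {ω | ε < maxWeightedSum a Xs n ω} = sumEvent a Xs ε n :=
    fun ε n => Set.ext fun ω => lt_maxWeightedSum_iff
  have hpnat : ∀ ε : ℝ, ∑' n : ℕ+, ENNReal.ofReal ((n : ℝ) ^ (r - 2)) *
        S.capacity {ω | ε < maxWeightedSum a Xs n ω} < ⊤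
      ↔ ∑' n : ℕ, ENNReal.ofReal ((n : ℝ) ^ (r - 2)) * S.capacity (sumEvent a Xs ε n) < ⊤ := by
    intro ε
    simp only [hev]
    exact ENNReal.tsum_pnat_lt_top_iff
      (f := fun n : ℕ => ENNReal.ofReal ((n : ℝ) ^ (r - 2)) * S.capacity (sumEvent a Xs ε n))
      (ENNReal.mul_lt_top ENNReal.ofReal_lt_top
        ((capacity_le_one _).trans_lt ENNReal.one_lt_top))
  simp only [hpnat]
  constructor
  · intro hI ε hε
    -- `q > 1/p` makes the row sums decay, `q ≤ r/p` gives the tail bound, `q < 2` the second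
    -- moment. For `p > 1` there is room for `q < 1`, where no centring is needed; for `p ≤ 1`
    -- necessarily `q > 1`, and the zero mean is used.
    obtain ⟨q, hq1, hqr, hq2, hq⟩ : ∃ q : ℝ, 1 / p < q ∧ q ≤ r / p ∧ q < 2 ∧
        (q < 1 ∨ 1 < q ∧ S.E X = 0 ∧ S.E (fun ω => -X ω) = 0) := by
      have hrp : 1 / p < r / p := by gcongr
      rcases lt_or_ge 1 p with h1p | h1p
      · obtain ⟨q, hq1, hq2⟩ := exists_between
          (lt_min ((div_lt_one hp0).2 h1p) hrp)
        rw [lt_min_iff] at hq2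
        exact ⟨q, hq1, hq2.2.le, by linarith [hq2.1], Or.inl hq2.1⟩
      · have h2 : 1 / p < 2 := by rw [div_lt_iff₀ hp0]; linarith
        obtain ⟨q, hq1, hq2⟩ := exists_between (lt_min h2 hrp)
        rw [lt_min_iff] at hq2
        have h3 : 1 ≤ 1 / p := (one_le_div hp0).2 h1p
        obtain ⟨hm1, hm2⟩ := hmean h1p
        exact ⟨q, hq1, hq2.2.le, hq2.1, Or.inr ⟨by linarith, hm1, by simpa using hm2⟩⟩
    have hq0 : 0 < q := lt_trans (by positivity) hq1
    obtain ⟨K, hK⟩ := exists_er_tail_le hX hf hlow hI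
    -- Markov's inequality is available only for `t ≥ 1`; enlarging `K` to `|K| + 1` covers small
    -- `t`, where the tail is at most one.
    have hg : ∀ t, 0 < t →
        S.er ({ω | t < |X ω|}.indicator fun _ => 1) ≤ (|K| + 1) * t ^ (-q) := by
      intro t ht
      rcases le_total 1 t with h1 | h1
      · calc _ ≤ K * t ^ (-(r / p)) := hK t h1
          _ ≤ (|K| + 1) * t ^ (-q) := by
            gcongr
            · linarith [le_abs_self K]
      · have hm : MeasurableSet {ω | t < |X ω|} :=
          measurableSet_lt measurable_const (S.measurable_of_mem _ hX).abs
        have h2 : S.er ({ω | t < |X ω|}.indicator fun _ => 1) ≤ 1 :=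
          er_le_of_le (Bounded.indicator hm) (Set.indicator_le_self' fun _ _ => zero_le_one)
        have h3 : 1 ≤ t ^ (-q) := Real.one_le_rpow_of_pos_of_le_one_of_nonpos ht h1 (by linarith)
        nlinarith [abs_nonneg K]
    obtain ⟨c, hc, A, hA, hcap⟩ := exists_capacity_sumEvent_le hS hX hXs hindep hident
      (by linarith : 0 < r) hβ hC₁ hpos hup hg hq0 hq2
      (by rwa [div_lt_iff₀ hp0, mul_comm] at hq1) hq hε
    exact tsum_capacity_sumEvent_lt_top (N := max (max N₁ N₂) 2) hA
      ((choquet_comp_abs_lt_top_iff hr hp0 hβ hf hG hc X).1 hI)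
      fun n hn => hcap n ((le_max_left _ _).trans hn) ((le_max_right _ _).trans hn)
  · intro h
    exact (choquet_comp_abs_lt_top_iff hr hp0 hβ hf hG one_pos X).2
      (tailSeries_lt_top_of_tsum_capacity_lt_top hX hXs hindep hident hr hβ hC₂ hdown h)

end SublinearExpectationSpace

theorem theorem3p1 {Ω : Type*} [MeasurableSpace Ω] (S : SublinearExpectationSpace Ω)
    (hS : S.CountablySubadditive)
    (X : Ω → ℝ) (hX : X ∈ S.H)
    (Xs : ℕ → Ω → ℝ) (hXs : ∀ n, 1 ≤ n → Xs n ∈ S.H)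
    (hindep : S.IndepSeq Xs)
    (hident : ∀ n, 1 ≤ n →
      SublinearExpectationSpace.IdentDistributed S S
        (fun _ : Fin 1 => Xs n) (fun _ : Fin 1 => X))
    (r p β : ℝ) (hr : 1 < r) (hp : 1 / 2 < p) (hβ : 0 < β + p)
    (hmean : p ≤ 1 → S.E X = 0 ∧ -S.E (fun ω => -X ω) = 0)
    (a : ℕ → ℕ → ℝ)
    (ha : ArrayApprox a (fun n i => ((i : ℝ) / (n : ℝ)) ^ β * (1 / (n : ℝ)) ^ p)) :
    ((-p < β → β < -p / r → S.choquet (fun ω => |X ω| ^ ((r - 1) / (p + β))) < ⊤) ∧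
      (β = -p / r → S.choquet (fun ω => |X ω| ^ (r / p) * Real.log (1 + |X ω|)) < ⊤) ∧
      (-p / r < β → S.choquet (fun ω => |X ω| ^ (r / p)) < ⊤)) ↔
    (∀ ε : ℝ, 0 < ε →
      ∑' n : ℕ+, ENNReal.ofReal ((n : ℝ) ^ (r - 2)) *
        S.capacity {ω | ε < maxWeightedSum a Xs n ω} < ⊤) := by
  have hp0 : 0 < p := by linarith
  have hr0 : 0 < r := by linarith
  have hrp : 0 < r / p := by positivity
  -- The constant `log 2` in the lower bound on the gauge comes from the critical case, where `log
  -- (1 + t) ≥ log 2` for `t ≥ 1`; the other two gauges satisfy the bound with room.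
  have hl2 : Real.log 2 ≤ 1 := by linarith [Real.log_two_lt_d9]
  rcases lt_trichotomy β (-p / r) with h | h | h
  · have hpb : 0 < p + β := by linarith
    -- Below the critical `β` the moment condition is the stronger one, so it still yields tails of
    -- order `t^(-r/p)`.
    have hexp : r / p ≤ (r - 1) / (p + β) := by
      rw [div_le_div_iff₀ hp0 hpb]
      rw [lt_div_iff₀ hr0] at h
      nlinarith
    have key := SublinearExpectationSpace.choquet_lt_top_iff_tsum_capacity hS hX hXs hindep hident
      hr hp hβ hmean ha (isIncreasingBijection_rpow (div_pos (by linarith) hpb))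
      (growthComparable_of_lt hr hp0 hβ h) fun t ht =>
        (mul_le_of_le_one_left (by positivity) hl2).trans
          (Real.rpow_le_rpow_of_exponent_le ht hexp)
    rw [← key]
    exact ⟨fun H => H.1 (by linarith) h,
      fun H => ⟨fun _ _ => H, fun h' => absurd h' h.ne, fun h' => absurd h' h.not_gt⟩⟩
  · have key := SublinearExpectationSpace.choquet_lt_top_iff_tsum_capacity hS hX hXs hindep hident
      hr hp hβ hmean ha (isIncreasingBijection_rpow_mul_log hrp)
      (growthComparable_of_eq hr hp0 h) fun t ht => by
        have := Real.log_le_log two_pos (by linarith : 2 ≤ 1 + t)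
        rw [mul_comm]
        gcongr
    rw [← key]
    exact ⟨fun H => H.2.1 h,
      fun H => ⟨fun _ h' => absurd h h'.ne, fun _ => H, fun h' => absurd h h'.ne'⟩⟩
  · have key := SublinearExpectationSpace.choquet_lt_top_iff_tsum_capacity hS hX hXs hindep hident
      hr hp hβ hmean ha (isIncreasingBijection_rpow hrp)
      (growthComparable_of_gt hr hp0 hβ h) fun t ht =>
        mul_le_of_le_one_left (by positivity) hl2
    rw [← key]
    exact ⟨fun H => H.2.2 h,
      fun H => ⟨fun _ h' => absurd h' h.not_gt, fun h' => absurd h' h.ne', fun _ => H⟩⟩
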